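/- Let $1<p<2$, let $p^*=p/(p-1)$ be its Hölder conjugate, and write $\|x\|_q=(\sum_i|x_i|^q)^{1/q}$ for $x\in\mathbb R^n$. For $n\ge 1$ let $G_n$ be a random $n\times n$ matrix whose entries $g_{ij}$, $1\le i,j\le n$, are i.i.d. standard Gaussian random variables, and let $\xi_{p^*}=(\mathbb E|z|^{p^*})^{1/p^*}$ for a standard Gaussian random variable $z$. Let $\bar G_n=(G_n+G_n^T)/\sqrt2$, with entries $\bar g_{ij}$, let $e_1,\dots,e_n$ be the standard basis of $\mathbb R^n$, and define $v_i\in\mathbb R^n$ by $$v_i(j)=\mathrm{sgn}(\bar g_{ij})\Bigl(\frac{|\bar g_{ij}|^{p^*}}{\|\bar G_ne_i\|_{p^*}^{p^*}}\Bigr)^{1/p},\qquad 1\le j\le n,$$ where $\mathrm{sgn}(a)=1$ if $a\ge 0$ and $\mathrm{sgn}(a)=-1$ if $a<0$. Let $$\mathcal O=\Bigl\{\pm\frac{e_i+v_i}{\|e_i+v_i\|_p}:1\le i\le n\Bigr\},$$ with the convention that a quotient with denominator $0$ is $0$ (for $n\ge2$ this concerns only an event of probability $0$). (i) If the matrices $G_n$,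 $n\ge1$, are defined on a common probability space (with an arbitrary joint law for different $n$), then almost surely $$\lim_{n\to\infty}\frac1{n^{1/p^*}}\max_{\|x\|_p=1}\langle G_nx,x\rangle=2^{\frac12-\frac2p}\,\xi_{p^*}.$$ (ii) Each $x\in\mathcal O$ is a near optimizer in the following sense: for every $d>0$ there is a constant $C>0$, depending only on $p$ and $d$, such that for every $n\ge1$, with probability at least $1-Cn^{-d}$, $$\min_{x\in\mathcal O}\langle G_nx,x\rangle\ \ge\ 2^{\frac12-\frac2p}\,\xi_{p^*}\,n^{\frac1{p^*}}-C\Bigl(n^{-\frac1p+\frac12+\frac1{p^*}}(\log n)^{\frac{p^*}4}+\sqrt{\log n}\Bigr).$$ -/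

import Mathlib

open MeasureTheory ProbabilityTheory Filter
open scoped Topology Matrix

noncomputable section

namespace LpGrothendieck

/-- The `ℓ_p`-norm `(∑ i, |x_i| ^ p) ^ (1 / p)` of a vector of `ℝⁿ`, for finite `p`. -/
def normP (p : ℝ) {n : ℕ} (x : Fin n → ℝ) : ℝ := (∑ i, |x i| ^ p) ^ (1 / p)

/-- The unit sphere of the `ℓ_p`-norm in `ℝⁿ`. -/
def unitSphere (p : ℝ) (n : ℕ) : Set (Fin n → ℝ) := {x | normP p x = 1}

/-- The quadratic form `⟨A x, x⟩`. -/
def quadForm {n : ℕ} (A : Matrix (Fin n) (Fin n) ℝ) (x : Fin n → ℝ) : ℝ := (A *ᵥ x) ⬝ᵥ x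

/-- The maximum of `⟨A x, x⟩` over the `ℓ_p`-unit sphere. For `n ≥ 1` it is attained, see
`isGreatest_maxForm`. -/
def maxForm (p : ℝ) {n : ℕ} (A : Matrix (Fin n) (Fin n) ℝ) : ℝ :=
  sSup (quadForm A '' unitSphere p n)

/-- `ξ_q = (𝔼 |z| ^ q) ^ (1 / q)` for a standard Gaussian random variable `z`. -/
def xi (q : ℝ) : ℝ := (∫ z, |z| ^ q ∂(gaussianReal 0 1)) ^ (1 / q)

/-- The random `n × n` matrix `G` has i.i.d. standard Gaussian entries. -/
structure IsStdGaussianMatrix {Ω : Type*} [MeasurableSpace Ω] (μ : Measure Ω) {n : ℕ}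
    (G : Ω → Matrix (Fin n) (Fin n) ℝ) : Prop where
  measurable : ∀ i j, Measurable fun ω => G ω i j
  law : ∀ i j, μ.map (fun ω => G ω i j) = gaussianReal 0 1
  indep : iIndepFun (fun (ij : Fin n × Fin n) ω => G ω ij.1 ij.2) μ

/-- The symmetrized matrix `(A + Aᵀ) / √2`. -/
def symMatrix {n : ℕ} (A : Matrix (Fin n) (Fin n) ℝ) : Matrix (Fin n) (Fin n) ℝ :=
  (√2)⁻¹ • (A + Aᵀ)

/-- The sign, with value `1` at `0`. -/
def sgn (a : ℝ) : ℝ := if 0 ≤ a then 1 else -1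

/-- The standard basis vector `e_i`. -/
def basisVec {n : ℕ} (i : Fin n) : Fin n → ℝ := Pi.single i 1

/-- `v_i(j) = sgn(B_ij) (|B_ij| ^ p* / ‖B e_i‖_{p*} ^ p*) ^ (1 / p)` with `B = (A + Aᵀ) / √2`,
where `p* = p / (p - 1)`. -/
def optVec (p : ℝ) {n : ℕ} (A : Matrix (Fin n) (Fin n) ℝ) (i : Fin n) : Fin n → ℝ := fun j =>
  sgn (symMatrix A i j) *
    (|symMatrix A i j| ^ p.conjExponent /
      normP p.conjExponent (symMatrix A *ᵥ basisVec i) ^ p.conjExponent) ^ (1 / p)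

/-- The set `𝒪` of the `2n` vectors `± (e_i + v_i) / ‖e_i + v_i‖_p`. -/
def optSet (p : ℝ) {n : ℕ} (A : Matrix (Fin n) (Fin n) ℝ) : Set (Fin n → ℝ) :=
  {x | ∃ i : Fin n,
    x = (normP p (basisVec i + optVec p A i))⁻¹ • (basisVec i + optVec p A i) ∨
    x = -((normP p (basisVec i + optVec p A i))⁻¹ • (basisVec i + optVec p A i))}

theorem isGreatest_maxForm {p : ℝ} (hp : 1 ≤ p) {n : ℕ} (hn : 1 ≤ n)
    (A : Matrix (Fin n) (Fin n) ℝ) :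
    IsGreatest (quadForm A '' unitSphere p n) (maxForm p A) := by
  have hp0 : 0 < p := by linarith
  have hcont : Continuous fun x : Fin n → ℝ => normP p x := by
    unfold normP
    refine Continuous.rpow_const (continuous_finsetSum _ fun i _ => ?_) fun _ => Or.inr (by positivity)
    exact Continuous.rpow_const (by fun_prop) fun _ => Or.inr hp0.le
  have hclosed : IsClosed (unitSphere p n) := isClosed_eq hcont continuous_const
  have hsub : unitSphere p n ⊆ Metric.closedBall 0 1 := by
    intro x hx
    have hs : 0 ≤ ∑ i, |x i| ^ p := Finset.sum_nonneg fun i _ => by positivity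
    have h1 : ∑ i, |x i| ^ p = 1 := by
      have hx' : (∑ i, |x i| ^ p) ^ (1 / p) = 1 := hx
      have := congrArg (fun t : ℝ => t ^ p) hx'
      simpa [← Real.rpow_mul hs, hp0.ne'] using this
    rw [mem_closedBall_zero_iff, pi_norm_le_iff_of_nonneg zero_le_one]
    intro i
    have h2 : |x i| ^ p ≤ 1 := h1 ▸ Finset.single_le_sum (f := fun i => |x i| ^ p)
      (fun i _ => by positivity) (Finset.mem_univ i)
    by_contra! h
    exact absurd h2 (not_le.2 (Real.one_lt_rpow h hp0))
  have hcomp : IsCompact (unitSphere p n) :=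
    (isCompact_closedBall (0 : Fin n → ℝ) 1).of_isClosed_subset hclosed hsub
  have hne : (unitSphere p n).Nonempty := by
    refine ⟨basisVec ⟨0, hn⟩, ?_⟩
    have : ∀ i : Fin n, |basisVec ⟨0, hn⟩ i| ^ p = if i = ⟨0, hn⟩ then (1 : ℝ) else 0 := by
      intro i
      by_cases h : i = ⟨0, hn⟩ <;> simp [basisVec, h, hp0.ne']
    simp [unitSphere, normP, this]
  have hq : Continuous (quadForm A) := by
    unfold quadForm
    fun_prop
  exact (hcomp.image hq).isGreatest_sSup (hne.image _)

end LpGrothendieck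

end

namespace LpGrothendieck

/-! Write q for p*. A near-maximizer puts half of its ℓ_p mass on a few coordinates and spreads the
other half over the rest as a Hölder dual. The cross term between the two halves dominates.

Upper bound. Cut x at height δ into x = u + w, where u carries the coordinates exceeding δ and hence
has few of them. Then ⟨Ax,x⟩ is the sum of ⟨Au,u⟩, ⟨Aw,w⟩ and two cross terms. The first is at most
the largest entry times ‖u‖_1². The second is written by layer cake as a double integral over level
sets, so `abs_bil_self_le` needs only a uniform bound on pairs of sign vectors; it gains a positive
power of δ because p < 2. For the cross terms, u is rounded to a grid vector z/N. Off the support of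
z the coordinates of (A + Aᵀ)z are i.i.d. Gaussians of variance 2‖z‖_2²
(`IsStdGaussianMatrix.symm_family`), so their ℓ_q norm is about √2 ‖z‖_2 ξ_q n^(1/q), uniformly over
the sparse grid. Hölder, ‖·‖_2 ≤ ‖·‖_p and ‖u‖_p ‖w‖_p ≤ 2^(-2/p) then give the constant √2 ·
2^(-2/p) ξ_q. `GoodMatrix.quadForm_le` is the deterministic statement and
`IsStdGaussianMatrix.goodMatrix_fail` the union bound.

Lower bound. For e_i + v_i the cross term is an equality case of Hölder, apart from the diagonal
entry, and equals about √2 times the ℓ_q norm of row i of the symmetrized matrix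
(`bil_basisVec_offVec`). That norm is bounded below by a lower tail estimate for sums of nonnegative
variables. The form on v_i without its i-th coordinate is Gaussian of variance at most 1
conditionally on row and column i (`IsStdGaussianMatrix.offVec_tail`). All errors are O(√log n),
which proves (ii) with a smaller error than required.

For (i), both bounds fail with probability O(n^(-2)), and Borel–Cantelli applies without any
assumption on the joint law. -/

/-- The bilinear form `∑ i j, A i j * x i * y j`. -/
def bil {n : ℕ} (A : Matrix (Fin n) (Fin n) ℝ) (x y : Fin n → ℝ) : ℝ :=
  ∑ i, ∑ j, A i j * x i * y j

/-- The number of nonzero coordinates of an integer vector. -/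
def suppCard {n : ℕ} (z : Fin n → ℤ) : ℕ := (Finset.univ.filter fun i => z i ≠ 0).card

/-! ### Bilinear forms and layer-cake bounds -/

section Deterministic

variable {n : ℕ} {p q : ℝ}

theorem quadForm_eq_bil (A : Matrix (Fin n) (Fin n) ℝ) (x : Fin n → ℝ) :
    quadForm A x = bil A x x := by
  unfold quadForm bil
  simp only [dotProduct, Matrix.mulVec, Finset.sum_mul]
  rw [Finset.sum_congr rfl fun i _ => Finset.sum_congr rfl fun j _ => ?_]
  ring

theorem bil_eq_sum_left (A : Matrix (Fin n) (Fin n) ℝ) (x y : Fin n → ℝ) :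
    bil A x y = ∑ i, (∑ j, A i j * y j) * x i := by
  unfold bil
  refine Finset.sum_congr rfl fun i _ => ?_
  rw [Finset.sum_mul]
  exact Finset.sum_congr rfl fun j _ => by ring

theorem bil_eq_sum_right (A : Matrix (Fin n) (Fin n) ℝ) (x y : Fin n → ℝ) :
    bil A x y = ∑ j, (∑ i, A i j * x i) * y j := by
  unfold bil
  rw [Finset.sum_comm]
  refine Finset.sum_congr rfl fun i _ => ?_
  rw [Finset.sum_mul]

theorem bil_add_left (A : Matrix (Fin n) (Fin n) ℝ) (x x' y : Fin n → ℝ) :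
    bil A (x + x') y = bil A x y + bil A x' y := by
  simp only [bil_eq_sum_left, Pi.add_apply, mul_add, Finset.sum_add_distrib]

theorem bil_add_right (A : Matrix (Fin n) (Fin n) ℝ) (x y y' : Fin n → ℝ) :
    bil A x (y + y') = bil A x y + bil A x y' := by
  simp only [bil_eq_sum_right, Pi.add_apply, mul_add, Finset.sum_add_distrib]

theorem bil_smul_left (A : Matrix (Fin n) (Fin n) ℝ) (c : ℝ) (x y : Fin n → ℝ) :
    bil A (c • x) y = c * bil A x y := by
  simp only [bil_eq_sum_left, Pi.smul_apply, smul_eq_mul, Finset.mul_sum]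
  exact Finset.sum_congr rfl fun i _ => by ring

theorem bil_smul_right (A : Matrix (Fin n) (Fin n) ℝ) (c : ℝ) (x y : Fin n → ℝ) :
    bil A x (c • y) = c * bil A x y := by
  simp only [bil_eq_sum_right, Pi.smul_apply, smul_eq_mul, Finset.mul_sum]
  exact Finset.sum_congr rfl fun i _ => by ring

theorem abs_bil_le {A : Matrix (Fin n) (Fin n) ℝ} {a : ℝ} (hA : ∀ i j, |A i j| ≤ a)
    (x y : Fin n → ℝ) : |bil A x y| ≤ a * (∑ i, |x i|) * ∑ j, |y j| := by
  unfold bil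
  calc |∑ i, ∑ j, A i j * x i * y j| ≤ ∑ i, ∑ j, |A i j * x i * y j| :=
        (Finset.abs_sum_le_sum_abs _ _).trans
          (Finset.sum_le_sum fun i _ => Finset.abs_sum_le_sum_abs _ _)
    _ ≤ ∑ i, ∑ j, a * |x i| * |y j| := by
        gcongr with i _ j _
        rw [abs_mul, abs_mul]
        gcongr
        exact hA i j
    _ = a * (∑ i, |x i|) * ∑ j, |y j| := by
        simp only [Finset.mul_sum, Finset.sum_mul]
        rw [Finset.sum_comm]

/-- Hölder's inequality against the indicator of a finite set. -/
theorem sum_abs_le_card_rpow (hpq : p.HolderConjugate q) {ι : Type*} (s : Finset ι) (x : ι → ℝ)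
    (hx : ∑ i ∈ s, |x i| ^ p ≤ 1) : ∑ i ∈ s, |x i| ≤ (s.card : ℝ) ^ (1 / q) := by
  have h := Real.inner_le_Lp_mul_Lq s (fun i => |x i|) (fun _ => 1) hpq
  simp only [mul_one, abs_abs, abs_one, Real.one_rpow, Finset.sum_const, nsmul_eq_mul] at h
  refine h.trans ?_
  have h0 : 0 ≤ ∑ i ∈ s, |x i| ^ p := Finset.sum_nonneg fun i _ => by positivity
  have h1 : (∑ i ∈ s, |x i| ^ p) ^ (1 / p) ≤ 1 :=
    Real.rpow_le_one h0 hx (by have := hpq.pos; positivity)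
  calc _ ≤ 1 * (s.card : ℝ) ^ (1 / q) := by gcongr
    _ = _ := one_mul _

/-- Markov's inequality for counting measure. -/
theorem rpow_mul_card_le {ι : Type*} [Fintype ι] {x : ι → ℝ} (hp : 0 < p) {t : ℝ} (ht : 0 ≤ t) :
    t ^ p * ((Finset.univ.filter fun i => t < |x i|).card : ℝ) ≤ ∑ i, |x i| ^ p := by
  calc _ = ∑ i ∈ Finset.univ.filter fun i => t < |x i|, t ^ p := by simp [mul_comm]
    _ ≤ ∑ i ∈ Finset.univ.filter fun i => t < |x i|, |x i| ^ p := by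
        refine Finset.sum_le_sum fun i hi => ?_
        have := (Finset.mem_filter.1 hi).2
        gcongr
    _ ≤ _ := Finset.sum_le_sum_of_subset_of_nonneg (Finset.filter_subset _ _)
        fun i _ _ => by positivity

/-- The sign vector of the coordinates of `x` larger than `t` in absolute value. -/
noncomputable def levelVec (x : Fin n → ℝ) (t : ℝ) : Fin n → ℤ :=
  fun i => if t < |x i| then (if 0 ≤ x i then 1 else -1) else 0

theorem abs_levelVec_le (x : Fin n → ℝ) (t : ℝ) (i : Fin n) : |levelVec x t i| ≤ 1 := by
  unfold levelVec
  split_ifs <;> simp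

theorem suppCard_levelVec (x : Fin n → ℝ) (t : ℝ) :
    suppCard (levelVec x t) = (Finset.univ.filter fun i => t < |x i|).card := by
  unfold suppCard levelVec
  congr 1
  ext i
  simp only [Finset.mem_filter, Finset.mem_univ, true_and]
  split_ifs <;> simp_all

/-- Monotonicity in the level supplies the interval integrability needed below. -/
theorem antitone_suppCard_levelVec (x : Fin n → ℝ) :
    Antitone fun t => suppCard (levelVec x t) := by
  intro s t hst
  simp only [suppCard_levelVec]
  refine Finset.card_le_card fun i hi => ?_
  simp only [Finset.mem_filter, Finset.mem_univ, true_and] at hi ⊢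
  exact hst.trans_lt hi

theorem intervalIntegrable_indicator_lt (a b c : ℝ) :
    IntervalIntegrable (fun t => if t < c then (1 : ℝ) else 0) volume a b := by
  refine Antitone.intervalIntegrable fun s t hst => ?_
  split_ifs with h1 h2 <;> first | exact le_rfl | exact zero_le_one | exact absurd (hst.trans_lt h1) h2

theorem integral_indicator_lt {c δ : ℝ} (hc : 0 ≤ c) (hcδ : c ≤ δ) :
    ∫ t in (0 : ℝ)..δ, (if t < c then (1 : ℝ) else 0) = c := by
  rw [← intervalIntegral.integral_add_adjacent_intervals
    (intervalIntegrable_indicator_lt 0 c c) (intervalIntegrable_indicator_lt c δ c)]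
  have h1 : ∫ t in (0 : ℝ)..c, (if t < c then (1 : ℝ) else 0) = ∫ t in (0 : ℝ)..c, (1 : ℝ) := by
    refine intervalIntegral.integral_congr_ae ?_
    have : ∀ᵐ t : ℝ, t ≠ c := by simp [ae_iff]
    filter_upwards [this] with t ht htm
    rw [Set.uIoc_of_le hc] at htm
    simp [lt_of_le_of_ne htm.2 ht]
  have h2 : ∫ t in c..δ, (if t < c then (1 : ℝ) else 0) = ∫ t in c..δ, (0 : ℝ) := by
    refine intervalIntegral.integral_congr fun t ht => ?_
    rw [Set.uIcc_of_le hcδ] at ht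
    simp [ht.1]
  rw [h1, h2]
  simp

theorem levelVec_cast (x : Fin n → ℝ) (t : ℝ) (i : Fin n) :
    ((levelVec x t i : ℤ) : ℝ) =
      (if 0 ≤ x i then (1 : ℝ) else -1) * (if t < |x i| then (1 : ℝ) else 0) := by
  unfold levelVec
  split_ifs <;> simp

/-- Layer-cake representation of a linear functional. -/
theorem sum_mul_eq_integral_levelVec (c : Fin n → ℝ) {x : Fin n → ℝ} {δ : ℝ}
    (hx : ∀ i, |x i| ≤ δ) :
    ∑ i, c i * x i = ∫ t in (0 : ℝ)..δ, ∑ i, c i * (levelVec x t i : ℝ) := by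
  rw [intervalIntegral.integral_finsetSum]
  · refine Finset.sum_congr rfl fun i _ => ?_
    simp only [levelVec_cast, intervalIntegral.integral_const_mul,
      integral_indicator_lt (abs_nonneg _) (hx i)]
    congr 1
    split_ifs with h
    · rw [abs_of_nonneg h, one_mul]
    · rw [abs_of_neg (not_le.1 h)]; ring
  · intro i _
    simp only [levelVec_cast]
    exact ((intervalIntegrable_indicator_lt _ _ _).const_mul _).const_mul _

theorem intervalIntegrable_suppCard (x : Fin n → ℝ) (a b : ℝ) :
    IntervalIntegrable (fun t => (suppCard (levelVec x t) : ℝ)) volume a b :=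
  Antitone.intervalIntegrable fun _ _ h => by exact_mod_cast antitone_suppCard_levelVec x h

theorem intervalIntegrable_sqrt_suppCard (x : Fin n → ℝ) (a b : ℝ) :
    IntervalIntegrable (fun t => √(suppCard (levelVec x t) : ℝ)) volume a b :=
  Antitone.intervalIntegrable fun _ _ h =>
    Real.sqrt_le_sqrt (by exact_mod_cast antitone_suppCard_levelVec x h)

theorem integral_suppCard_levelVec {x : Fin n → ℝ} {δ : ℝ} (hx : ∀ i, |x i| ≤ δ) :
    ∫ t in (0 : ℝ)..δ, (suppCard (levelVec x t) : ℝ) = ∑ i, |x i| := by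
  have : ∀ t, (suppCard (levelVec x t) : ℝ) = ∑ i, if t < |x i| then (1 : ℝ) else 0 := by
    intro t
    rw [suppCard_levelVec]
    simp
  simp only [this]
  rw [intervalIntegral.integral_finsetSum fun i _ => intervalIntegrable_indicator_lt _ _ _]
  exact Finset.sum_congr rfl fun i _ => integral_indicator_lt (abs_nonneg _) (hx i)

/-- By Markov the level set at height t has at most t^(-p) elements, so the integrand is at most
t^(-p/2), which is integrable at 0 exactly because p < 2. -/
theorem integral_sqrt_suppCard_levelVec_le (hp : 0 < p) (hp2 : p < 2) {x : Fin n → ℝ}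
    (hx : ∑ i, |x i| ^ p ≤ 1) {δ : ℝ} (hδ : 0 ≤ δ) :
    ∫ t in (0 : ℝ)..δ, √(suppCard (levelVec x t) : ℝ) ≤ δ ^ (1 - p / 2) / (1 - p / 2) := by
  have h1 : ∫ t in (0 : ℝ)..δ, t ^ (-(p / 2)) = δ ^ (1 - p / 2) / (1 - p / 2) := by
    rw [integral_rpow (Or.inl (by linarith))]
    rw [Real.zero_rpow (by linarith)]
    ring_nf
  rw [← h1]
  refine intervalIntegral.integral_mono_on_of_le_Ioo hδ (intervalIntegrable_sqrt_suppCard _ _ _)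
    (intervalIntegral.intervalIntegrable_rpow' (by linarith)) fun t ht => ?_
  rw [suppCard_levelVec]
  have h2 := (rpow_mul_card_le (x := x) hp ht.1.le).trans hx
  have htp : 0 < t ^ p := Real.rpow_pos_of_pos ht.1 p
  rw [Real.sqrt_le_left (Real.rpow_nonneg ht.1.le _), ← Real.rpow_natCast,
    ← Real.rpow_mul ht.1.le]
  have h3 : -(p / 2) * ((2 : ℕ) : ℝ) = -p := by push_cast; ring
  rw [h3, Real.rpow_neg ht.1.le, ← one_div, le_div_iff₀ htp]
  linarith

/-- A bound for `A` on pairs of sign vectors yields a bound for the quadratic form on vectors of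
the `ℓ_p`-ball with small coordinates. -/
theorem abs_bil_self_le (hpq : p.HolderConjugate q) (hp2 : p < 2)
    {A : Matrix (Fin n) (Fin n) ℝ} {K : ℝ} (hK : 0 ≤ K)
    (hA : ∀ z z' : Fin n → ℤ, (∀ i, |z i| ≤ 1) → (∀ i, |z' i| ≤ 1) →
      |bil A (fun i => z i) (fun i => z' i)| ≤
        K * (√(suppCard z) * suppCard z' + suppCard z * √(suppCard z')))
    {x : Fin n → ℝ} (hx : ∑ i, |x i| ^ p ≤ 1) {δ : ℝ} (hδ : 0 ≤ δ) (hxδ : ∀ i, |x i| ≤ δ) :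
    |bil A x x| ≤ 2 * K * (δ ^ (1 - p / 2) / (1 - p / 2)) * (n : ℝ) ^ (1 / q) := by
  set a := ∫ t in (0 : ℝ)..δ, √(suppCard (levelVec x t) : ℝ) with ha
  set b := ∫ t in (0 : ℝ)..δ, (suppCard (levelVec x t) : ℝ) with hb
  have hi1 := intervalIntegrable_sqrt_suppCard x 0 δ
  have hi2 := intervalIntegrable_suppCard x 0 δ
  -- The layer cake is applied one argument at a time: here the first argument is a frozen sign
  -- vector, and `h2` then integrates over the level sets of the first argument too.
  have h1 : ∀ z : Fin n → ℤ, (∀ i, |z i| ≤ 1) →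
      |bil A (fun i => z i) x| ≤ K * (√(suppCard z) * b + suppCard z * a) := by
    intro z hz
    rw [bil_eq_sum_right, sum_mul_eq_integral_levelVec _ hxδ, ← Real.norm_eq_abs]
    refine (intervalIntegral.norm_integral_le_of_norm_le hδ
      (g := fun t => K * (√(suppCard z) * suppCard (levelVec x t) +
        suppCard z * √(suppCard (levelVec x t)))) (ae_of_all _ fun t _ => ?_) ?_).trans_eq ?_
    · rw [← bil_eq_sum_right A (fun i => (z i : ℝ)) fun i => (levelVec x t i : ℝ)]
      exact hA z _ hz (abs_levelVec_le x t)
    · exact ((hi2.const_mul _).add (hi1.const_mul _)).const_mul _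
    · rw [intervalIntegral.integral_const_mul, intervalIntegral.integral_add
        (hi2.const_mul _) (hi1.const_mul _), intervalIntegral.integral_const_mul,
        intervalIntegral.integral_const_mul]
  have h2 : |bil A x x| ≤ K * (a * b + b * a) := by
    rw [bil_eq_sum_left, sum_mul_eq_integral_levelVec _ hxδ, ← Real.norm_eq_abs]
    refine (intervalIntegral.norm_integral_le_of_norm_le hδ
      (g := fun t => K * (√(suppCard (levelVec x t)) * b +
        suppCard (levelVec x t) * a)) (ae_of_all _ fun t _ => ?_) ?_).trans_eq ?_
    · rw [← bil_eq_sum_left A (fun i => (levelVec x t i : ℝ)) x]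
      exact h1 _ (abs_levelVec_le x t)
    · exact ((hi1.mul_const _).add (hi2.mul_const _)).const_mul _
    · rw [intervalIntegral.integral_const_mul, intervalIntegral.integral_add
        (hi1.mul_const _) (hi2.mul_const _), intervalIntegral.integral_mul_const,
        intervalIntegral.integral_mul_const]
  have hb0 : 0 ≤ b := intervalIntegral.integral_nonneg hδ fun t _ => by positivity
  have hb1 : b ≤ (n : ℝ) ^ (1 / q) := by
    rw [hb, integral_suppCard_levelVec hxδ]
    simpa using sum_abs_le_card_rpow hpq Finset.univ x hx
  have ha1 := integral_sqrt_suppCard_levelVec_le hpq.pos hp2 hx hδ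
  have ha0 : 0 ≤ a := intervalIntegral.integral_nonneg hδ fun t _ => by positivity
  calc _ ≤ K * (a * b + b * a) := h2
    _ = 2 * K * a * b := by ring
    _ ≤ _ := mul_le_mul (mul_le_mul_of_nonneg_left ha1 (by positivity)) hb1 hb0
        (mul_nonneg (by positivity) (ha0.trans ha1))

end Deterministic

/-! ### Deterministic upper bound for good matrices -/

section UpperBound

variable {n : ℕ} {p q : ℝ}

/-- AM–GM applied to a^p and b^p; the extremal case of equal masses is the source of the constant
2^(-2/p). -/
theorem mul_le_of_rpow_add_rpow_le (hp : 0 < p) {a b : ℝ} (ha : 0 ≤ a) (hb : 0 ≤ b)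
    (h : a ^ p + b ^ p ≤ 1) : a * b ≤ (2 : ℝ) ^ (-(2 / p)) := by
  have h1 : (a * b) ^ p ≤ 1 / 4 := by
    rw [Real.mul_rpow ha hb]
    have := Real.rpow_nonneg ha p
    have := Real.rpow_nonneg hb p
    nlinarith [sq_nonneg (a ^ p - b ^ p)]
  have h2 : a * b ≤ (1 / 4 : ℝ) ^ (1 / p) := by
    have := Real.rpow_le_rpow (by positivity) h1 (by positivity : 0 ≤ 1 / p)
    rwa [← Real.rpow_mul (by positivity), mul_one_div_cancel hp.ne', Real.rpow_one] at this
  refine h2.trans_eq ?_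
  rw [show (1 / 4 : ℝ) = 2 ^ (-2 : ℝ) by norm_num [Real.rpow_neg],
    ← Real.rpow_mul (by norm_num)]
  congr 1
  ring

/-- Each coordinate is at most the ℓ_p norm a, so x² = |x|^p |x|^(2-p) ≤ |x|^p a^(2-p), and these
sum to a². -/
theorem sqrt_sum_sq_le {ι : Type*} (s : Finset ι) (hp : 0 < p) (hp2 : p ≤ 2) (x : ι → ℝ) :
    √(∑ i ∈ s, x i ^ 2) ≤ (∑ i ∈ s, |x i| ^ p) ^ (1 / p) := by
  set a := (∑ i ∈ s, |x i| ^ p) ^ (1 / p) with ha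
  have hs : 0 ≤ ∑ i ∈ s, |x i| ^ p := Finset.sum_nonneg fun i _ => by positivity
  have ha0 : 0 ≤ a := by positivity
  have hap : a ^ p = ∑ i ∈ s, |x i| ^ p := by
    rw [ha, ← Real.rpow_mul hs, one_div_mul_cancel hp.ne', Real.rpow_one]
  have hle : ∀ i ∈ s, |x i| ≤ a := fun i hi => by
    have h1 : |x i| ^ p ≤ a ^ p := by
      rw [hap]
      exact Finset.single_le_sum (f := fun i => |x i| ^ p) (fun i _ => by positivity) hi
    exact (Real.rpow_le_rpow_iff (abs_nonneg _) ha0 hp).1 h1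
  rw [Real.sqrt_le_left ha0]
  rcases ha0.eq_or_lt with h0 | h0
  · refine (Finset.sum_nonpos fun i hi => ?_).trans (sq_nonneg a)
    have h2 := hle i hi
    rw [← h0] at h2
    simp [abs_nonpos_iff.1 h2]
  calc ∑ i ∈ s, x i ^ 2 ≤ ∑ i ∈ s, |x i| ^ p * a ^ (2 - p) := by
        refine Finset.sum_le_sum fun i hi => ?_
        rcases eq_or_ne (x i) 0 with hx | hx
        · simp [hx, hp.ne']
        have hx' : 0 < |x i| := abs_pos.2 hx
        calc x i ^ 2 = |x i| ^ (p + (2 - p)) := by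
              rw [show p + (2 - p) = ((2 : ℕ) : ℝ) by norm_num, Real.rpow_natCast, sq_abs]
          _ = |x i| ^ p * |x i| ^ (2 - p) := Real.rpow_add hx' _ _
          _ ≤ _ := by
              gcongr
              exact hle i hi
    _ = a ^ (p + (2 - p)) := by rw [← Finset.sum_mul, ← hap, Real.rpow_add h0]
    _ = a ^ 2 := by
        rw [show p + (2 - p) = ((2 : ℕ) : ℝ) by norm_num, Real.rpow_natCast]

/-- Rounding of the vector `N • x` towards zero. -/
noncomputable def roundVec (N : ℕ) (x : Fin n → ℝ) : Fin n → ℤ :=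
  fun i => if 0 ≤ x i then ⌊N * |x i|⌋ else -⌊N * |x i|⌋

theorem abs_roundVec (N : ℕ) (x : Fin n → ℝ) (i : Fin n) :
    |roundVec N x i| = ⌊N * |x i|⌋ := by
  have : 0 ≤ ⌊(N : ℝ) * |x i|⌋ := Int.floor_nonneg.2 (by positivity)
  unfold roundVec
  split_ifs
  · exact abs_of_nonneg this
  · rw [abs_neg, abs_of_nonneg this]

theorem roundVec_eq_zero {N : ℕ} {x : Fin n → ℝ} {i : Fin n} (h : x i = 0) :
    roundVec N x i = 0 := by simp [roundVec, h]

theorem abs_sub_roundVec_le {N : ℕ} (hN : 1 ≤ N) (x : Fin n → ℝ) (i : Fin n) :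
    |x i - (N : ℝ)⁻¹ * roundVec N x i| ≤ (N : ℝ)⁻¹ := by
  have hN0 : (0 : ℝ) < N := by exact_mod_cast hN
  have h : |N * x i - roundVec N x i| ≤ 1 := by
    have h1 := Int.floor_le ((N : ℝ) * |x i|)
    have h2 := Int.lt_floor_add_one ((N : ℝ) * |x i|)
    unfold roundVec
    split_ifs with h
    · rw [abs_of_nonneg h] at *
      rw [abs_le]; constructor <;> linarith
    · rw [abs_of_neg (not_le.1 h)] at *
      push_cast
      rw [abs_le]; constructor <;> linarith
  calc |x i - (N : ℝ)⁻¹ * roundVec N x i| = |(N : ℝ)⁻¹ * (N * x i - roundVec N x i)| := by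
        congr 1
        field_simp
    _ = (N : ℝ)⁻¹ * |N * x i - roundVec N x i| := by rw [abs_mul, abs_of_pos (by positivity)]
    _ ≤ (N : ℝ)⁻¹ * 1 := by gcongr
    _ = _ := mul_one _

theorem abs_smul_roundVec_le {N : ℕ} (hN : 1 ≤ N) (x : Fin n → ℝ) (i : Fin n) :
    |(N : ℝ)⁻¹ * roundVec N x i| ≤ |x i| := by
  have hN0 : (0 : ℝ) < N := by exact_mod_cast hN
  rw [abs_mul, abs_of_pos (by positivity), ← Int.cast_abs, abs_roundVec, inv_mul_le_iff₀ hN0]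
  exact Int.floor_le _

/-- The bounds satisfied with high probability by a Gaussian matrix. -/
structure GoodMatrix (q K L : ℝ) (N k : ℕ) (A : Matrix (Fin n) (Fin n) ℝ) : Prop where
  sign_bound : ∀ z z' : Fin n → ℤ, (∀ i, |z i| ≤ 1) → (∀ i, |z' i| ≤ 1) →
      |bil A (fun i => z i) (fun i => z' i)| ≤
        K * (√(suppCard z) * suppCard z' + suppCard z * √(suppCard z'))
  grid_bound : ∀ z : Fin n → ℤ, (∀ i, |z i| ≤ N) → suppCard z ≤ k →
      ∑ j ∈ Finset.univ.filter (fun j => z j = 0), |∑ i, (A j i + A i j) * z i| ^ q ≤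
        (√2 * √(∑ i, (z i : ℝ) ^ 2)) ^ q * L

/-- The sign bound is evaluated at two basis vectors, whose supports have one element each. -/
theorem GoodMatrix.abs_entry_le {K L : ℝ} {N k : ℕ} {A : Matrix (Fin n) (Fin n) ℝ}
    (h : GoodMatrix q K L N k A) (i j : Fin n) : |A i j| ≤ 2 * K := by
  have h1 := h.sign_bound (Pi.single i 1) (Pi.single j 1)
    (fun l => by by_cases hl : l = i <;> simp [hl])
    (fun l => by by_cases hl : l = j <;> simp [hl])
  have h2 : ∀ i : Fin n, suppCard (Pi.single i (1 : ℤ)) = 1 := fun i => by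
    simp [suppCard, Pi.single_apply, Finset.filter_eq']
  have h3 : bil A (fun l => ((Pi.single i (1 : ℤ) : Fin n → ℤ) l : ℝ))
      (fun l => ((Pi.single j (1 : ℤ) : Fin n → ℤ) l : ℝ)) = A i j := by
    unfold bil
    simp [Pi.single_apply]
  rw [h3, h2, h2] at h1
  simp at h1
  linarith

theorem GoodMatrix.nonneg {K L : ℝ} {N k : ℕ} {A : Matrix (Fin n) (Fin n) ℝ}
    (h : GoodMatrix q K L N k A) (hn : 1 ≤ n) : 0 ≤ K := by
  have := (abs_nonneg _).trans (h.abs_entry_le ⟨0, hn⟩ ⟨0, hn⟩)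
  linarith

theorem bil_add_bil_swap (A : Matrix (Fin n) (Fin n) ℝ) (u w : Fin n → ℝ) :
    bil A u w + bil A w u = ∑ j, (∑ i, (A j i + A i j) * u i) * w j := by
  rw [bil_eq_sum_right A u w, bil_eq_sum_left A w u, ← Finset.sum_add_distrib]
  refine Finset.sum_congr rfl fun j _ => ?_
  rw [← add_mul, ← Finset.sum_add_distrib]
  congr 1
  exact Finset.sum_congr rfl fun i _ => by ring

theorem rpow_one_div_rpow {a : ℝ} (ha : 0 ≤ a) (hp : p ≠ 0) : (a ^ p) ^ (1 / p) = a := by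
  rw [← Real.rpow_mul ha, mul_one_div_cancel hp, Real.rpow_one]

/-- The cross term of a localized vector on the grid and a disjointly supported vector. -/
theorem GoodMatrix.cross_le {K L : ℝ} (hL : 0 ≤ L) {N k : ℕ} {A : Matrix (Fin n) (Fin n) ℝ}
    (h : GoodMatrix q K L N k A) (hpq : p.HolderConjugate q) {z : Fin n → ℤ}
    (hz : ∀ i, |z i| ≤ N) (hzk : suppCard z ≤ k) {w : Fin n → ℝ}
    (hw : ∀ i, z i ≠ 0 → w i = 0) :
    bil A (fun i => z i) w + bil A w (fun i => z i) ≤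
      √2 * √(∑ i, (z i : ℝ) ^ 2) * L ^ (1 / q) * (∑ i, |w i| ^ p) ^ (1 / p) := by
  rw [bil_add_bil_swap]
  -- Coordinates in the support of z drop out because w vanishes there; what remains is the sum
  -- controlled by `grid_bound`.
  rw [← Finset.sum_subset (Finset.subset_univ (Finset.univ.filter (fun j => z j = 0)))
    fun j _ hj => by
      rw [hw j (by simpa using hj), mul_zero]]
  refine (Real.inner_le_Lp_mul_Lq _ _ _ hpq.symm).trans ?_
  have hq := hpq.symm.pos
  have hp := hpq.pos
  have h1 := Real.rpow_le_rpow (Finset.sum_nonneg fun i _ => by positivity)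
    (h.grid_bound z hz hzk) (by positivity : 0 ≤ 1 / q)
  rw [Real.mul_rpow (by positivity) hL, rpow_one_div_rpow (by positivity) hq.ne'] at h1
  gcongr
  exact Finset.subset_univ _

/-- The four terms on the right are, in order, the cross terms with the rounded large part, the
large part with itself, the small part with itself, and the cross terms with the rounding error. -/
theorem GoodMatrix.quadForm_le {K L : ℝ} (hL : 0 ≤ L) {N k : ℕ} (hN : 1 ≤ N) (hn : 1 ≤ n)
    {A : Matrix (Fin n) (Fin n) ℝ}
    (h : GoodMatrix q K L N k A) (hpq : p.HolderConjugate q) (hp2 : p < 2) {δ : ℝ} (hδ : 0 < δ)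
    (hk : δ ^ (-p) ≤ k) {x : Fin n → ℝ} (hx : ∑ i, |x i| ^ p = 1) :
    quadForm A x ≤ √2 * 2 ^ (-(2 / p)) * L ^ (1 / q) + 2 * K * ((k : ℝ) ^ (1 / q)) ^ 2 +
      2 * K * (δ ^ (1 - p / 2) / (1 - p / 2)) * (n : ℝ) ^ (1 / q) +
      4 * K * (k / N) * (n : ℝ) ^ (1 / q) := by
  have hp := hpq.pos
  have hq := hpq.symm.pos
  have hK := h.nonneg hn
  have hN0 : (0 : ℝ) < N := by exact_mod_cast hN
  set S : Finset (Fin n) := Finset.univ.filter fun i => δ < |x i| with hS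
  set u : Fin n → ℝ := fun i => if i ∈ S then x i else 0 with hu
  set w : Fin n → ℝ := fun i => if i ∈ S then 0 else x i with hw
  set z := roundVec N u with hz
  set r : Fin n → ℝ := fun i => u i - (N : ℝ)⁻¹ * z i with hr
  -- Markov again: fewer than δ^(-p) coordinates, up to equality, can exceed δ.
  have hSk : (S.card : ℝ) ≤ k := by
    refine le_trans ?_ hk
    have h1 := (rpow_mul_card_le (x := x) hp hδ.le).trans_eq hx
    rw [Real.rpow_neg hδ.le, ← one_div, le_div_iff₀ (Real.rpow_pos_of_pos hδ p), mul_comm]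
    exact h1
  have hxuw : x = u + w := by
    ext i
    by_cases hi : i ∈ S <;> simp [hu, hw, hi]
  have huz : u = (N : ℝ)⁻¹ • (fun i => (z i : ℝ)) + r := by
    ext i
    exact (add_sub_cancel _ _).symm
  have hsum : ∑ i, |u i| ^ p + ∑ i, |w i| ^ p = 1 := by
    rw [← hx, ← Finset.sum_add_distrib]
    refine Finset.sum_congr rfl fun i _ => ?_
    by_cases hi : i ∈ S <;> simp [hu, hw, hi, hp.ne']
  have hu0 : 0 ≤ ∑ i, |u i| ^ p := Finset.sum_nonneg fun i _ => by positivity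
  have hw0 : 0 ≤ ∑ i, |w i| ^ p := Finset.sum_nonneg fun i _ => by positivity
  have hu1 : ∀ i, |u i| ≤ 1 := fun i => by
    have h1 : |u i| ^ p ≤ 1 := (Finset.single_le_sum (f := fun i => |u i| ^ p)
      (fun i _ => by positivity) (Finset.mem_univ i)).trans (by linarith)
    by_contra! h2
    exact absurd h1 (not_le.2 (Real.one_lt_rpow h2 hp))
  have huS : ∑ i, |u i| ≤ (k : ℝ) ^ (1 / q) := by
    have h1 : ∑ i, |u i| = ∑ i ∈ S, |u i| :=
      (Finset.sum_subset (Finset.subset_univ S) fun i _ hi => by simp [hu, hi]).symm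
    have h2 : ∑ i ∈ S, |u i| ^ p ≤ 1 := (Finset.sum_le_sum_of_subset_of_nonneg
      (Finset.subset_univ S) fun i _ _ => by positivity).trans (by linarith)
    rw [h1]
    exact (sum_abs_le_card_rpow hpq S u h2).trans
      (Real.rpow_le_rpow (Nat.cast_nonneg _) hSk (by positivity))
  have hwn : ∑ i, |w i| ≤ (n : ℝ) ^ (1 / q) := by
    simpa using sum_abs_le_card_rpow hpq Finset.univ w (by linarith)
  have hrS : ∑ i, |r i| ≤ k / N := by
    have h1 : ∑ i, |r i| = ∑ i ∈ S, |r i| :=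
      (Finset.sum_subset (Finset.subset_univ S) fun i _ hi => by
        have : u i = 0 := by simp [hu, hi]
        have h0 : z i = 0 := roundVec_eq_zero this
        simp [hr, this, h0]).symm
    rw [h1]
    calc ∑ i ∈ S, |r i| ≤ ∑ i ∈ S, (N : ℝ)⁻¹ :=
          Finset.sum_le_sum fun i _ => abs_sub_roundVec_le hN u i
      _ = S.card / N := by simp [div_eq_mul_inv]
      _ ≤ _ := by gcongr
  have hzS : ∀ i, z i ≠ 0 → i ∈ S := fun i hi => by
    by_contra h1
    exact hi (roundVec_eq_zero (by simp [hu, h1]))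
  have hzk : suppCard z ≤ k := by
    have : suppCard z ≤ S.card :=
      Finset.card_le_card fun i hi => hzS i (Finset.mem_filter.1 hi).2
    exact this.trans (by exact_mod_cast hSk)
  have hzN : ∀ i, |z i| ≤ N := fun i => by
    rw [hz, abs_roundVec]
    refine Int.floor_le_iff.2 ?_
    push_cast
    nlinarith [hu1 i, abs_nonneg (u i)]
  have huu : bil A u u ≤ 2 * K * ((k : ℝ) ^ (1 / q)) ^ 2 := by
    refine (le_abs_self _).trans ((abs_bil_le h.abs_entry_le u u).trans ?_)
    rw [pow_two, ← mul_assoc]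
    gcongr
  have hww : bil A w w ≤ 2 * K * (δ ^ (1 - p / 2) / (1 - p / 2)) * (n : ℝ) ^ (1 / q) := by
    refine (le_abs_self _).trans (abs_bil_self_le hpq hp2 hK h.sign_bound (by linarith) hδ.le ?_)
    intro i
    by_cases hi : i ∈ S
    · simp [hw, hi, hδ.le]
    · simp only [hw, hi, if_false]
      simpa [hS] using hi
  have hrw : bil A r w + bil A w r ≤ 4 * K * (k / N) * (n : ℝ) ^ (1 / q) := by
    have h1 : bil A r w ≤ 2 * K * (k / N) * (n : ℝ) ^ (1 / q) := by
      refine (le_abs_self _).trans ((abs_bil_le h.abs_entry_le r w).trans ?_)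
      gcongr
    have h2 : bil A w r ≤ 2 * K * (n : ℝ) ^ (1 / q) * (k / N) := by
      refine (le_abs_self _).trans ((abs_bil_le h.abs_entry_le w r).trans ?_)
      gcongr
    linarith
  have hzw : (N : ℝ)⁻¹ * (bil A (fun i => z i) w + bil A w (fun i => z i)) ≤
      √2 * 2 ^ (-(2 / p)) * L ^ (1 / q) := by
    have h1 := h.cross_le hL hpq hzN hzk (w := w) fun i hi => by simp [hw, hzS i hi]
    -- Rounding towards zero never increases a coordinate, so the ℓ_2 norm of z/N passes through its
    -- ℓ_p norm to that of u without loss.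
    have h2 : (N : ℝ)⁻¹ * √(∑ i, (z i : ℝ) ^ 2) ≤ (∑ i, |u i| ^ p) ^ (1 / p) := by
      calc (N : ℝ)⁻¹ * √(∑ i, (z i : ℝ) ^ 2) = √(∑ i, ((N : ℝ)⁻¹ * z i) ^ 2) := by
            simp only [mul_pow]
            rw [← Finset.mul_sum, Real.sqrt_mul (by positivity), Real.sqrt_sq (by positivity)]
        _ ≤ (∑ i, |(N : ℝ)⁻¹ * z i| ^ p) ^ (1 / p) := sqrt_sum_sq_le _ hp hp2.le _
        _ ≤ _ := by
            exact Real.rpow_le_rpow (Finset.sum_nonneg fun i _ => by positivity)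
              (Finset.sum_le_sum fun i _ => Real.rpow_le_rpow (abs_nonneg _)
                (abs_smul_roundVec_le hN u i) hp.le) (by positivity)
    have h3 : (∑ i, |u i| ^ p) ^ (1 / p) * (∑ i, |w i| ^ p) ^ (1 / p) ≤ 2 ^ (-(2 / p)) := by
      refine mul_le_of_rpow_add_rpow_le hp (by positivity) (by positivity) ?_
      rw [← Real.rpow_mul hu0, ← Real.rpow_mul hw0, one_div_mul_cancel hp.ne', Real.rpow_one,
        Real.rpow_one, hsum]
    calc _ ≤ (N : ℝ)⁻¹ * (√2 * √(∑ i, (z i : ℝ) ^ 2) * L ^ (1 / q) *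
          (∑ i, |w i| ^ p) ^ (1 / p)) := by gcongr
      _ = √2 * L ^ (1 / q) * (((N : ℝ)⁻¹ * √(∑ i, (z i : ℝ) ^ 2)) *
          (∑ i, |w i| ^ p) ^ (1 / p)) := by ring
      _ ≤ √2 * L ^ (1 / q) * ((∑ i, |u i| ^ p) ^ (1 / p) *
          (∑ i, |w i| ^ p) ^ (1 / p)) := by gcongr
      _ ≤ √2 * L ^ (1 / q) * 2 ^ (-(2 / p)) := by gcongr
      _ = _ := by ring
  have hexp : quadForm A x = (N : ℝ)⁻¹ * (bil A (fun i => z i) w + bil A w (fun i => z i)) +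
      bil A u u + bil A w w + (bil A r w + bil A w r) := by
    have h1 : bil A u w = (N : ℝ)⁻¹ * bil A (fun i => z i) w + bil A r w := by
      conv_lhs => rw [huz]
      rw [bil_add_left, bil_smul_left]
    have h2 : bil A w u = (N : ℝ)⁻¹ * bil A w (fun i => z i) + bil A w r := by
      conv_lhs => rw [huz]
      rw [bil_add_right, bil_smul_right]
    rw [quadForm_eq_bil, hxuw, bil_add_left, bil_add_right, bil_add_right, h1, h2]
    ring
  rw [hexp]
  linarith

end UpperBound

/-! ### Tail bounds for i.i.d. Gaussian families -/

/-- A finite family of i.i.d. standard Gaussian random variables. -/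
structure IsStdGaussianFamily {Ω ι : Type*} [MeasurableSpace Ω] (μ : Measure Ω)
    (X : ι → Ω → ℝ) : Prop where
  measurable : ∀ i, Measurable (X i)
  law : ∀ i, μ.map (X i) = gaussianReal 0 1
  indep : iIndepFun X μ

/-- The moment `𝔼 |z| ^ q` of a standard Gaussian random variable. -/
noncomputable def gaussMoment (q : ℝ) : ℝ := ∫ z, |z| ^ q ∂(gaussianReal 0 1)

theorem integrable_abs_rpow_gaussianReal {q : ℝ} (hq : 0 ≤ q) :
    Integrable (fun z : ℝ => |z| ^ q) (gaussianReal 0 1) := by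
  have h : ((0 : ℝ)) ∈ interior (integrableExpSet id (gaussianReal 0 1)) := by simp
  exact integrable_rpow_abs_of_mem_interior_integrableExpSet h hq

theorem gaussMoment_pos {q : ℝ} (hq : 0 ≤ q) : 0 < gaussMoment q := by
  unfold gaussMoment
  rw [integral_pos_iff_support_of_nonneg (fun z => by positivity)
    (integrable_abs_rpow_gaussianReal hq)]
  have : NullSingletonClass (gaussianReal 0 1) := nullSingletonClass_gaussianReal one_ne_zero
  have h1 : ({0}ᶜ : Set ℝ) ⊆ Function.support fun z : ℝ => |z| ^ q := fun z hz =>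
    (Real.rpow_pos_of_pos (abs_pos.2 hz) q).ne'
  refine lt_of_lt_of_le ?_ (measure_mono h1)
  rw [prob_compl_eq_one_sub (measurableSet_singleton 0), measure_singleton]
  simp

theorem HasSubgaussianMGF.mono {Ω : Type*} [MeasurableSpace Ω] {μ : Measure Ω} {X : Ω → ℝ}
    {c d : NNReal} (h : HasSubgaussianMGF X c μ) (hcd : c ≤ d) : HasSubgaussianMGF X d μ :=
  ⟨h.integrable_exp_mul, fun t => (h.mgf_le t).trans (Real.exp_le_exp.2 (by gcongr))⟩

section Family

variable {Ω ι : Type*} [MeasurableSpace Ω] {μ : Measure Ω} {X : ι → Ω → ℝ}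

theorem IsStdGaussianFamily.hasGaussianLaw (h : IsStdGaussianFamily μ X) (i : ι) :
    HasGaussianLaw (X i) μ where
  isGaussian_map := by rw [h.law]; infer_instance

theorem IsStdGaussianFamily.hasSubgaussianMGF (h : IsStdGaussianFamily μ X) (i : ι) :
    HasSubgaussianMGF (X i) 1 μ where
  integrable_exp_mul t := by
    have := integrable_exp_mul_gaussianReal (μ := 0) (v := 1) t
    rw [← h.law i, integrable_map_measure (by fun_prop) (h.measurable i).aemeasurable] at this
    exact this
  mgf_le t := by rw [mgf_gaussianReal (h.law i)]; simp

theorem IsStdGaussianFamily.integral_comp (h : IsStdGaussianFamily μ X) (i : ι) {f : ℝ → ℝ}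
    (hf : Measurable f) : ∫ ω, f (X i ω) ∂μ = ∫ z, f z ∂(gaussianReal 0 1) := by
  rw [← h.law i, integral_map (h.measurable i).aemeasurable hf.aestronglyMeasurable]

theorem IsStdGaussianFamily.integrable_comp (h : IsStdGaussianFamily μ X) (i : ι) {f : ℝ → ℝ}
    (hf : Measurable f) (hi : Integrable f (gaussianReal 0 1)) :
    Integrable (fun ω => f (X i ω)) μ := by
  rw [← h.law i, integrable_map_measure hf.aestronglyMeasurable (h.measurable i).aemeasurable] at hi
  exact hi

theorem IsStdGaussianFamily.covariance [DecidableEq ι] (h : IsStdGaussianFamily μ X) (i j : ι) :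
    cov[X i, X j; μ] = if i = j then 1 else 0 := by
  split_ifs with hij
  · subst hij
    rw [covariance_self (h.measurable i).aemeasurable]
    have := (h.hasGaussianLaw i).isProbabilityMeasure
    have h1 : HasLaw (X i) (gaussianReal 0 1) μ := ⟨(h.measurable i).aemeasurable, h.law i⟩
    rw [h1.variance_eq, variance_id_gaussianReal]
    simp
  · exact (h.indep.indepFun hij).covariance_eq_zero (h.hasGaussianLaw i).memLp_two
      (h.hasGaussianLaw j).memLp_two

/-- A linear image of a Gaussian vector is jointly Gaussian, so orthonormality of the coefficient
vectors, which makes the forms uncorrelated with unit variance, already makes them independent. -/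
theorem IsStdGaussianFamily.linearForms [Fintype ι] {κ : Type*} [Finite κ] [DecidableEq κ]
    (h : IsStdGaussianFamily μ X) (c : κ → ι → ℝ)
    (hc : ∀ k l, ∑ i, c k i * c l i = if k = l then 1 else 0) :
    IsStdGaussianFamily μ (fun k ω => ∑ i, c k i * X i ω) := by
  classical
  cases nonempty_fintype κ
  have := h.indep.isProbabilityMeasure
  have hcov : ∀ k l, cov[fun ω => ∑ i, c k i * X i ω, fun ω => ∑ i, c l i * X i ω; μ] =
      if k = l then 1 else 0 := by
    intro k l
    rw [covariance_fun_sum_fun_sum (fun i => (h.hasGaussianLaw i).memLp_two.const_mul _)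
      (fun i => (h.hasGaussianLaw i).memLp_two.const_mul _)]
    simp only [covariance_const_mul_left, covariance_const_mul_right, h.covariance]
    simp [← hc k l, mul_comm]
  let L : (ι → ℝ) →L[ℝ] (κ → ℝ) :=
    ContinuousLinearMap.pi fun k => ∑ i, c k i • ContinuousLinearMap.proj i
  have hG : HasGaussianLaw (fun ω k => ∑ i, c k i * X i ω) μ := by
    have := (h.indep.hasGaussianLaw h.hasGaussianLaw).map_fun L
    have h1 : (fun ω k => ∑ i, c k i * X i ω) = fun ω => L (X · ω) := by
      ext ω k
      simp [L]
    rwa [h1]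
  have hmeas : ∀ k, Measurable fun ω => ∑ i, c k i * X i ω := fun k =>
    Finset.measurable_fun_sum _ fun i _ => (h.measurable i).const_mul _
  refine ⟨hmeas, fun k => ?_, ?_⟩
  · have hk := HasGaussianLaw.eval hG k
    rw [hk.map_eq_gaussianReal]
    have h1 : ∫ ω, ∑ i, c k i * X i ω ∂μ = 0 := by
      rw [integral_finsetSum _ fun i _ => (h.hasGaussianLaw i).integrable.const_mul _]
      refine Finset.sum_eq_zero fun i _ => ?_
      rw [integral_const_mul, h.integral_comp i measurable_id']
      simp
    have h2 : Var[fun ω => ∑ i, c k i * X i ω; μ] = 1 := by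
      rw [← covariance_self (hmeas k).aemeasurable, hcov]
      simp
    rw [h1, h2]
    simp
  · refine HasGaussianLaw.iIndepFun_of_covariance_eq_zero hG fun k l hkl => ?_
    rw [hcov k l, if_neg hkl]

theorem IsStdGaussianFamily.abs_sum_tail [Fintype ι]
    (h : IsStdGaussianFamily μ X) {c : ι → ℝ} {v t : ℝ} (hv : ∑ i, c i ^ 2 ≤ v) (ht : 0 ≤ t) :
    μ.real {ω | t ≤ |∑ i, c i * X i ω|} ≤ 2 * Real.exp (-t ^ 2 / (2 * v)) := by
  have := h.indep.isProbabilityMeasure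
  have hv0 : 0 ≤ v := (Finset.sum_nonneg fun i _ => sq_nonneg _).trans hv
  have hind : iIndepFun (fun i ω => c i * X i ω) μ :=
    h.indep.comp (fun i x => c i * x) fun i => measurable_const_mul _
  have hsg : ∀ i, HasSubgaussianMGF (fun ω => c i * X i ω) (c i ^ 2).toNNReal μ := fun i => by
    refine HasSubgaussianMGF.mono ((h.hasSubgaussianMGF i).const_mul (c i)) (le_of_eq ?_)
    exact (mul_one _).trans (NNReal.eq (Real.coe_toNNReal _ (sq_nonneg _)).symm)
  have hs : HasSubgaussianMGF (fun ω => ∑ i, c i * X i ω) v.toNNReal μ := by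
    refine HasSubgaussianMGF.mono (HasSubgaussianMGF.sum_of_iIndepFun hind (s := Finset.univ)
      fun i _ => hsg i) ?_
    rw [← Real.toNNReal_sum_of_nonneg fun i _ => sq_nonneg _]
    exact Real.toNNReal_le_toNNReal hv
  have hsub : {ω | t ≤ |∑ i, c i * X i ω|} ⊆
      {ω | t ≤ ∑ i, c i * X i ω} ∪ {ω | t ≤ -∑ i, c i * X i ω} := fun ω hω => by
    simpa [le_abs] using hω
  refine (measureReal_mono hsub).trans ((measureReal_union_le _ _).trans ?_)
  have h1 := hs.measure_ge_le ht
  have h2 := hs.neg.measure_ge_le ht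
  simp only [Pi.neg_apply, Real.coe_toNNReal v hv0] at h1 h2
  linarith

theorem IsStdGaussianFamily.abs_tail (h : IsStdGaussianFamily μ X) (i : ι) {t : ℝ} (ht : 0 ≤ t) :
    μ.real {ω | t ≤ |X i ω|} ≤ 2 * Real.exp (-t ^ 2 / 2) := by
  have := h.indep.isProbabilityMeasure
  have h1 : IsStdGaussianFamily μ (fun _ : Unit => X i) :=
    ⟨fun _ => h.measurable i, fun _ => h.law i, iIndepFun.of_subsingleton⟩
  simpa using h1.abs_sum_tail (c := fun _ => 1) (v := 1) (by simp) ht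

/-- For large q the powers have no exponential moments, so they are truncated at T^q. Hoeffding
handles the bounded variables, and a union bound the event that some |X i| reaches T. The count
enters only through an upper bound n, since supports of different sizes are treated uniformly. -/
theorem IsStdGaussianFamily.sum_abs_rpow_upper_tail [Fintype ι] (h : IsStdGaussianFamily μ X)
    {q : ℝ} (hq : 0 < q) {n : ℕ} (hn : Fintype.card ι ≤ n) {T ε : ℝ} (hT : 0 < T) (hε : 0 ≤ ε) :
    μ.real {ω | n * (gaussMoment q + ε) ≤ ∑ i, |X i ω| ^ q} ≤
      2 * n * Real.exp (-T ^ 2 / 2) + Real.exp (-(2 * n * ε ^ 2) / (T ^ q) ^ 2) := by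
  have := h.indep.isProbabilityMeasure
  have hTq : 0 < T ^ q := Real.rpow_pos_of_pos hT q
  set f : ℝ → ℝ := fun z => min (|z| ^ q) (T ^ q) with hf
  have hfm : Measurable f := by fun_prop
  have hf0 : ∀ z, 0 ≤ f z := fun z => le_min (by positivity) hTq.le
  -- Truncation only lowers the mean, which is the favourable direction for an upper tail.
  have hfi : ∀ i, ∫ ω, f (X i ω) ∂μ ≤ gaussMoment q := fun i => by
    rw [h.integral_comp i hfm]
    exact integral_mono_of_nonneg (ae_of_all _ hf0) (integrable_abs_rpow_gaussianReal hq.le)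
      (ae_of_all _ fun z => min_le_left _ _)
  have hind : iIndepFun (fun i ω => f (X i ω) - ∫ ω, f (X i ω) ∂μ) μ :=
    h.indep.comp (fun i x => f x - ∫ ω, f (X i ω) ∂μ) fun i => hfm.sub_const _
  have hsub : ∀ i, HasSubgaussianMGF (fun ω => f (X i ω) - ∫ ω, f (X i ω) ∂μ)
      ((‖T ^ q - 0‖₊ / 2) ^ 2) μ := fun i =>
    hasSubgaussianMGF_of_mem_Icc (hfm.comp (h.measurable i)).aemeasurable
      (ae_of_all _ fun ω => ⟨hf0 _, min_le_right _ _⟩)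
  have hs : HasSubgaussianMGF (fun ω => ∑ i, (f (X i ω) - ∫ ω, f (X i ω) ∂μ))
      (n * (‖T ^ q - 0‖₊ / 2) ^ 2) μ := by
    refine HasSubgaussianMGF.mono (HasSubgaussianMGF.sum_of_iIndepFun hind (s := Finset.univ)
      fun i _ => hsub i) ?_
    simp only [Finset.sum_const, Finset.card_univ, nsmul_eq_mul]
    gcongr
  have h1 := hs.measure_ge_le (ε := n * ε) (by positivity)
  have h2 : μ.real (⋃ i, {ω | T ≤ |X i ω|}) ≤ 2 * n * Real.exp (-T ^ 2 / 2) := by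
    refine (measureReal_iUnion_fintype_le _).trans ?_
    calc ∑ i, μ.real {ω | T ≤ |X i ω|} ≤ ∑ _i : ι, 2 * Real.exp (-T ^ 2 / 2) :=
          Finset.sum_le_sum fun i _ => h.abs_tail i hT.le
      _ = Fintype.card ι * (2 * Real.exp (-T ^ 2 / 2)) := by simp
      _ ≤ n * (2 * Real.exp (-T ^ 2 / 2)) := by gcongr
      _ = _ := by ring
  have hcover : {ω | n * (gaussMoment q + ε) ≤ ∑ i, |X i ω| ^ q} ⊆
      (⋃ i, {ω | T ≤ |X i ω|}) ∪
        {ω | n * ε ≤ ∑ i, (f (X i ω) - ∫ ω, f (X i ω) ∂μ)} := by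
    intro ω hω
    by_cases hT' : ∃ i, T ≤ |X i ω|
    · exact Or.inl (Set.mem_iUnion.2 hT')
    right
    push Not at hT'
    have h3 : ∀ i, f (X i ω) = |X i ω| ^ q := fun i =>
      min_eq_left (Real.rpow_le_rpow (abs_nonneg _) (hT' i).le hq.le)
    have h4 : ∑ i, ∫ ω, f (X i ω) ∂μ ≤ n * gaussMoment q := by
      calc ∑ i, ∫ ω, f (X i ω) ∂μ ≤ ∑ _i : ι, gaussMoment q := Finset.sum_le_sum fun i _ => hfi i
        _ = Fintype.card ι * gaussMoment q := by simp
        _ ≤ _ := by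
          have := (gaussMoment_pos hq.le).le
          gcongr
    simp only [Set.mem_ofPred_eq, Finset.sum_sub_distrib, h3] at hω ⊢
    linarith
  refine (measureReal_mono hcover).trans ((measureReal_union_le _ _).trans (add_le_add h2 ?_))
  refine h1.trans (Real.exp_le_exp.2 (le_of_eq ?_))
  push_cast
  rw [sub_zero, Real.norm_of_nonneg hTq.le]
  rcases Nat.eq_zero_or_pos n with hn0 | hn0
  · simp [hn0]
  have : (0 : ℝ) < n := by exact_mod_cast hn0
  field_simp

/-- The product of 1 + x + x²/2 and 1 - x + x²/2 is 1 + x⁴/4 ≥ 1. -/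
theorem exp_neg_le_quadratic {x : ℝ} (hx : 0 ≤ x) : Real.exp (-x) ≤ 1 - x + x ^ 2 / 2 := by
  rw [Real.exp_neg]
  have h1 := Real.quadratic_le_exp_of_nonneg hx
  refine (inv_anti₀ (by positivity) h1).trans ?_
  rw [inv_le_iff_one_le_mul₀ (by positivity)]
  nlinarith [sq_nonneg (x ^ 2)]

/-- The summands are nonnegative, so their Laplace transform at negative arguments is controlled by
two moments through `exp_neg_le_quadratic`; no truncation is needed. -/
theorem IsStdGaussianFamily.sum_abs_rpow_lower_tail [Fintype ι] (h : IsStdGaussianFamily μ X)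
    {q : ℝ} (hq : 0 < q) {n : ℕ} (hn1 : 1 ≤ n) (hn : Fintype.card ι ≤ n) {s : ℝ} (hs : 0 ≤ s) :
    μ.real {ω | ∑ i, |X i ω| ^ q ≤ Fintype.card ι * gaussMoment q - s} ≤
      Real.exp (-s ^ 2 / (2 * n * gaussMoment (2 * q))) := by
  have := h.indep.isProbabilityMeasure
  set m := gaussMoment q with hm
  set M := gaussMoment (2 * q) with hM
  have hM0 : 0 < M := gaussMoment_pos (by positivity)
  have hn0 : (0 : ℝ) < n := by exact_mod_cast hn1
  -- This is the minimizer of -τ s + n τ² M / 2 in the Chernoff bound.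
  set τ := s / (n * M) with hτ
  have hτ0 : 0 ≤ τ := by positivity
  have hYm : ∀ i, Measurable fun ω => |X i ω| ^ q := fun i => by
    have := h.measurable i
    fun_prop
  have hint : ∀ i, Integrable (fun ω => Real.exp (-τ * |X i ω| ^ q)) μ := fun i => by
    refine Integrable.of_bound (C := 1) ?_ (ae_of_all _ fun ω => ?_)
    · exact ((hYm i).const_mul _).exp.aestronglyMeasurable
    · rw [Real.norm_of_nonneg (Real.exp_pos _).le, Real.exp_le_one_iff]
      have : 0 ≤ |X i ω| ^ q := by positivity
      nlinarith
  have hmgf : ∀ i, mgf (fun ω => |X i ω| ^ q) μ (-τ) ≤ Real.exp (-τ * m + τ ^ 2 * M / 2) := by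
    intro i
    have hi1 : Integrable (fun ω => |X i ω| ^ q) μ :=
      h.integrable_comp i (f := fun z => |z| ^ q) (by fun_prop)
        (integrable_abs_rpow_gaussianReal hq.le)
    have hi2 : Integrable (fun ω => |X i ω| ^ (2 * q)) μ :=
      h.integrable_comp i (f := fun z => |z| ^ (2 * q)) (by fun_prop)
        (integrable_abs_rpow_gaussianReal (by positivity))
    have e1 : ∫ ω, |X i ω| ^ q ∂μ = m := h.integral_comp i (f := fun z => |z| ^ q) (by fun_prop)
    have e2 : ∫ ω, |X i ω| ^ (2 * q) ∂μ = M :=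
      h.integral_comp i (f := fun z => |z| ^ (2 * q)) (by fun_prop)
    calc mgf (fun ω => |X i ω| ^ q) μ (-τ)
        ≤ ∫ ω, (1 - τ * |X i ω| ^ q + τ ^ 2 / 2 * |X i ω| ^ (2 * q)) ∂μ := by
          refine integral_mono (hint i)
            (((integrable_const 1).sub (hi1.const_mul τ)).add (hi2.const_mul _)) fun ω => ?_
          have h0 : 0 ≤ |X i ω| ^ q := by positivity
          have h1 := exp_neg_le_quadratic (mul_nonneg hτ0 h0)
          have h2 : |X i ω| ^ (2 * q) = (|X i ω| ^ q) ^ 2 := by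
            rw [← Real.rpow_natCast, ← Real.rpow_mul (abs_nonneg _)]
            push_cast
            ring_nf
          simp only [neg_mul, h2]
          linarith
      _ = 1 + (-τ * m + τ ^ 2 * M / 2) := by
          have hi3 : Integrable (fun ω => 1 - τ * |X i ω| ^ q) μ :=
            (integrable_const 1).sub (hi1.const_mul τ)
          rw [integral_add hi3 (hi2.const_mul _),
            integral_sub (integrable_const 1) (hi1.const_mul τ), integral_const_mul,
            integral_const_mul, e1, e2]
          simp
          ring
      _ ≤ _ := by
          rw [add_comm]
          exact Real.add_one_le_exp _
  have hind : iIndepFun (fun i ω => |X i ω| ^ q) μ :=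
    h.indep.comp (fun _ x => |x| ^ q) fun _ => by fun_prop
  have hsum : mgf (fun ω => ∑ i, |X i ω| ^ q) μ (-τ) ≤
      Real.exp (Fintype.card ι * (-τ * m + τ ^ 2 * M / 2)) := by
    have h1 := hind.mgf_sum (t := -τ) hYm Finset.univ
    have h2 : (∑ i, fun ω => |X i ω| ^ q) = fun ω => ∑ i, |X i ω| ^ q := by
      rw [Finset.sum_fn]
    rw [h2] at h1
    rw [h1]
    calc ∏ i, mgf (fun ω => |X i ω| ^ q) μ (-τ)
        ≤ ∏ _i : ι, Real.exp (-τ * m + τ ^ 2 * M / 2) :=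
          Finset.prod_le_prod (fun i _ => mgf_nonneg) fun i _ => hmgf i
      _ = _ := by simp [← Real.exp_nat_mul]
  have hint' : Integrable (fun ω => Real.exp (-τ * ∑ i, |X i ω| ^ q)) μ := by
    refine Integrable.of_bound (C := 1) ?_ (ae_of_all _ fun ω => ?_)
    · exact ((Finset.measurable_fun_sum _ fun i _ => hYm i).const_mul _).exp.aestronglyMeasurable
    · rw [Real.norm_of_nonneg (Real.exp_pos _).le, Real.exp_le_one_iff]
      have : 0 ≤ ∑ i, |X i ω| ^ q := Finset.sum_nonneg fun i _ => by positivity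
      nlinarith
  refine (measure_le_le_exp_mul_mgf _ (neg_nonpos.2 hτ0) hint').trans ?_
  calc _ ≤ Real.exp (- -τ * (Fintype.card ι * m - s)) *
        Real.exp (Fintype.card ι * (-τ * m + τ ^ 2 * M / 2)) := by gcongr
    _ = Real.exp (-τ * s + Fintype.card ι * (τ ^ 2 * M / 2)) := by
        rw [← Real.exp_add]
        ring_nf
    _ ≤ Real.exp (-τ * s + n * (τ ^ 2 * M / 2)) := by gcongr
    _ = _ := by
        congr 1
        rw [hτ]
        field_simp
        ring

end Family

/-! ### Counting and union bounds for Gaussian matrices -/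

/-- Generating function of the support size over the integer vectors of a cube. -/
theorem sum_pow_suppCard (n N : ℕ) (r : ℝ) :
    ∑ z ∈ Fintype.piFinset fun _ : Fin n => Finset.Icc (-(N : ℤ)) N, r ^ suppCard z =
      (1 + 2 * N * r) ^ n := by
  have h1 : ∑ a ∈ Finset.Icc (-(N : ℤ)) N, (if a ≠ 0 then r else 1) = 1 + 2 * N * r := by
    rw [← Finset.add_sum_erase _ _ (Finset.mem_Icc.2 ⟨by simp, by simp⟩ : (0 : ℤ) ∈ _)]
    rw [Finset.sum_congr rfl fun a ha => if_pos (Finset.ne_of_mem_erase ha), Finset.sum_const,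
      Finset.card_erase_of_mem (Finset.mem_Icc.2 ⟨by simp, by simp⟩), Int.card_Icc]
    simp only [ne_eq, not_true_eq_false, if_false, nsmul_eq_mul]
    have : ((N : ℤ) + 1 - -N).toNat - 1 = 2 * N := by omega
    rw [this]
    push_cast
    ring
  rw [← h1, Finset.sum_pow']
  refine Finset.sum_congr rfl fun z _ => ?_
  rw [Finset.prod_ite]
  simp [suppCard]

section GaussianMatrix

variable {Ω : Type*} [MeasurableSpace Ω] {μ : Measure Ω} {n : ℕ}
  {G : Ω → Matrix (Fin n) (Fin n) ℝ}

theorem IsStdGaussianMatrix.family (h : IsStdGaussianMatrix μ G) :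
    IsStdGaussianFamily μ (fun (ij : Fin n × Fin n) ω => G ω ij.1 ij.2) :=
  ⟨fun ij => h.measurable ij.1 ij.2, fun ij => h.law ij.1 ij.2, h.indep⟩

theorem IsStdGaussianMatrix.abs_bil_tail (h : IsStdGaussianMatrix μ G) (x y : Fin n → ℝ) {v t : ℝ}
    (hv : (∑ i, x i ^ 2) * ∑ i, y i ^ 2 ≤ v) (ht : 0 ≤ t) :
    μ.real {ω | t ≤ |bil (G ω) x y|} ≤ 2 * Real.exp (-t ^ 2 / (2 * v)) := by
  have h1 : ∑ ij : Fin n × Fin n, (x ij.1 * y ij.2) ^ 2 ≤ v := by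
    refine le_of_eq_of_le ?_ hv
    rw [Fintype.sum_prod_type, Finset.sum_mul_sum]
    simp only [mul_pow]
  have h2 := h.family.abs_sum_tail h1 ht
  have h3 : ∀ ω, bil (G ω) x y = ∑ ij : Fin n × Fin n, x ij.1 * y ij.2 * G ω ij.1 ij.2 := by
    intro ω
    rw [Fintype.sum_prod_type]
    exact Finset.sum_congr rfl fun i _ => Finset.sum_congr rfl fun j _ => by ring
  simpa only [h3] using h2

/-- The coordinates of the symmetrized matrix applied to a unit vector are i.i.d. outside of the
support of this vector. -/
theorem IsStdGaussianMatrix.symm_family (h : IsStdGaussianMatrix μ G) {u : Fin n → ℝ}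
    (hu : ∑ i, u i ^ 2 = 1) :
    IsStdGaussianFamily μ
      (fun (j : {j : Fin n // u j = 0}) ω => (√2)⁻¹ * ∑ i, (G ω j i + G ω i j) * u i) := by
  have hs : (√2)⁻¹ * (√2)⁻¹ = (1 / 2 : ℝ) := by
    rw [← mul_inv, Real.mul_self_sqrt (by norm_num)]
    norm_num
  have h1 := h.family.linearForms (κ := {j : Fin n // u j = 0})
    (fun j ab => (√2)⁻¹ * ((if ab.1 = j.1 then u ab.2 else 0) + if ab.2 = j.1 then u ab.1 else 0))
    (by
      intro k l
      have e : ∀ x : Fin n × Fin n,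
          (√2)⁻¹ * ((if x.1 = k.1 then u x.2 else 0) + if x.2 = k.1 then u x.1 else 0) *
          ((√2)⁻¹ * ((if x.1 = l.1 then u x.2 else 0) + if x.2 = l.1 then u x.1 else 0)) =
          1 / 2 * ((if x.1 = k.1 then u x.2 * (if x.1 = l.1 then u x.2 else 0) else 0) +
            (if x.1 = k.1 then u x.2 * (if x.2 = l.1 then u x.1 else 0) else 0) +
            (if x.2 = k.1 then u x.1 * (if x.1 = l.1 then u x.2 else 0) else 0) +
            (if x.2 = k.1 then u x.1 * (if x.2 = l.1 then u x.1 else 0) else 0)) := by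
        intro x
        rw [mul_mul_mul_comm, hs]
        split_ifs <;> ring
      simp only [e]
      rw [← Finset.mul_sum, Finset.sum_add_distrib, Finset.sum_add_distrib,
        Finset.sum_add_distrib]
      simp only [Fintype.sum_prod_type]
      -- Of the four products, the two mixed ones contain u at k and at l, where u vanishes. The
      -- other two each contribute ∑ u² when k = l, and the factor 1/2 normalizes them.
      have hk := k.2
      have hl := l.2
      by_cases hkl : k = l
      · subst hkl
        simp [Finset.sum_ite_irrel, hk, ← pow_two, hu]
        norm_num
      · have hkl' : k.1 ≠ l.1 := fun h => hkl (Subtype.ext h)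
        simp [Finset.sum_ite_irrel, hk, hl, hkl, hkl'])
  convert h1 using 3 with j ω
  rw [Fintype.sum_prod_type]
  simp only [mul_assoc, ← Finset.mul_sum, add_mul, Finset.sum_add_distrib, ite_mul, zero_mul]
  congr 1
  congr 1
  · simp [Finset.sum_ite_irrel, mul_comm]
  · simp [mul_comm]

/-- After division by the Euclidean norm of z, the off-support coordinates form a standard family
and the truncated upper tail applies. -/
theorem IsStdGaussianMatrix.grid_tail (h : IsStdGaussianMatrix μ G) {q : ℝ} (hq : 0 < q)
    {T ε : ℝ} (hT : 0 < T) (hε : 0 ≤ ε) (z : Fin n → ℤ) :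
    μ.real {ω | (√2 * √(∑ i, (z i : ℝ) ^ 2)) ^ q * (n * (gaussMoment q + ε)) <
      ∑ j ∈ Finset.univ.filter (fun j => z j = 0), |∑ i, (G ω j i + G ω i j) * z i| ^ q} ≤
      2 * n * Real.exp (-T ^ 2 / 2) + Real.exp (-(2 * n * ε ^ 2) / (T ^ q) ^ 2) := by
  have := h.indep.isProbabilityMeasure
  have hm := (gaussMoment_pos hq.le).le
  set v := √(∑ i, (z i : ℝ) ^ 2) with hv
  -- For z = 0 normalization is impossible, but both sides vanish and the strict inequality makes
  -- the event empty.
  rcases (Real.sqrt_nonneg (∑ i, (z i : ℝ) ^ 2)).eq_or_lt with h0 | h0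
  · have hz : ∀ i, z i = 0 := fun i => by
      have h1 := (Real.sqrt_eq_zero (Finset.sum_nonneg fun i _ => sq_nonneg _)).1 h0.symm
      rw [Finset.sum_eq_zero_iff_of_nonneg fun i _ => sq_nonneg _] at h1
      simpa using h1 i (Finset.mem_univ i)
    refine le_of_eq_of_le ?_ (by positivity)
    convert measureReal_empty (μ := μ) using 2
    ext ω
    have : v = 0 := h0.symm
    simp [hz, this, hq.ne']
  change 0 < v at h0
  have hu : ∑ i, (v⁻¹ * z i) ^ 2 = 1 := by
    simp only [mul_pow]
    rw [← Finset.mul_sum, inv_pow, hv, Real.sq_sqrt (Finset.sum_nonneg fun i _ => sq_nonneg _)]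
    refine inv_mul_cancel₀ fun h1 => ?_
    rw [hv, h1, Real.sqrt_zero] at h0
    exact lt_irrefl _ h0
  have hcard : Fintype.card {j : Fin n // v⁻¹ * (z j : ℝ) = 0} ≤ n :=
    (Fintype.card_subtype_le _).trans (by simp)
  refine (measureReal_mono ?_).trans
    ((h.symm_family hu).sum_abs_rpow_upper_tail hq hcard hT hε)
  intro ω hω
  simp only [Set.mem_ofPred_eq] at hω ⊢
  have e : ∀ j : Fin n, |(√2)⁻¹ * ∑ i, (G ω j i + G ω i j) * (v⁻¹ * z i)| ^ q =
      ((√2 * v) ^ q)⁻¹ * |∑ i, (G ω j i + G ω i j) * z i| ^ q := by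
    intro j
    rw [← Real.inv_rpow (by positivity), ← Real.mul_rpow (by positivity) (by positivity)]
    congr 1
    rw [← abs_of_pos (show 0 < (√2 * v)⁻¹ by positivity), ← abs_mul]
    congr 1
    rw [mul_inv, mul_assoc]
    congr 1
    rw [Finset.mul_sum]
    exact Finset.sum_congr rfl fun i _ => by ring
  have hs : ∑ j : {j : Fin n // v⁻¹ * (z j : ℝ) = 0},
      |(√2)⁻¹ * ∑ i, (G ω j i + G ω i j) * (v⁻¹ * z i)| ^ q =
      ((√2 * v) ^ q)⁻¹ * ∑ j ∈ Finset.univ.filter (fun j => z j = 0),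
        |∑ i, (G ω j i + G ω i j) * z i| ^ q := by
    simp only [e]
    rw [← Finset.mul_sum]
    congr 1
    symm
    refine Finset.sum_subtype _ (fun j => ?_) _
    simp [h0.ne']
  rw [hs, ← div_eq_inv_mul, le_div_iff₀ (by positivity), mul_comm]
  exact hω.le

/-- With support sizes a and b the variance is at most ab, while (√a b + a √b)² ≥ ab(a + b). The
exponent is thus at least K²(a + b)/2, and the bound factorizes over the two vectors, as the union
bound requires. -/
theorem IsStdGaussianMatrix.sign_tail (h : IsStdGaussianMatrix μ G) {K : ℝ} (hK : 0 ≤ K)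
    {z z' : Fin n → ℤ} (hz : ∀ i, |z i| ≤ 1) (hz' : ∀ i, |z' i| ≤ 1) (hs : 1 ≤ suppCard z)
    (hs' : 1 ≤ suppCard z') :
    μ.real {ω | K * (√(suppCard z) * suppCard z' + suppCard z * √(suppCard z')) <
      |bil (G ω) (fun i => z i) (fun i => z' i)|} ≤
      2 * (Real.exp (-K ^ 2 / 2) ^ suppCard z * Real.exp (-K ^ 2 / 2) ^ suppCard z') := by
  have := h.indep.isProbabilityMeasure
  have hsq : ∀ z : Fin n → ℤ, (∀ i, |z i| ≤ 1) → ∑ i, (z i : ℝ) ^ 2 ≤ suppCard z := by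
    intro z hz
    have : ((suppCard z : ℕ) : ℝ) = ∑ i, if z i ≠ 0 then (1 : ℝ) else 0 := by
      rw [Finset.sum_boole]
      rfl
    rw [this]
    refine Finset.sum_le_sum fun i _ => ?_
    have := abs_le.1 (hz i)
    have : z i = -1 ∨ z i = 0 ∨ z i = 1 := by omega
    rcases this with h | h | h <;> simp [h]
  set a : ℝ := (suppCard z : ℝ) with ha
  set b : ℝ := (suppCard z' : ℝ) with hb
  have ha0 : 0 < a := by rw [ha]; exact_mod_cast hs
  have hb0 : 0 < b := by rw [hb]; exact_mod_cast hs'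
  have htail := h.abs_bil_tail (fun i => (z i : ℝ)) (fun i => (z' i : ℝ)) (v := a * b)
    (mul_le_mul (hsq z hz) (hsq z' hz') (Finset.sum_nonneg fun i _ => sq_nonneg _) ha0.le)
    (t := K * (√a * b + a * √b)) (by positivity)
  refine (measureReal_mono (fun ω hω => ?_) (measure_ne_top _ _)).trans (htail.trans ?_)
  · simp only [Set.mem_ofPred_eq] at hω ⊢
    exact hω.le
  · rw [← Real.exp_nat_mul, ← Real.exp_nat_mul, ← Real.exp_add]
    gcongr
    rw [div_le_iff₀ (by positivity)]
    have h1 : (√a * b + a * √b) ^ 2 = a * b * (a + b + 2 * (√a * √b)) := by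
      have e1 := Real.sq_sqrt ha0.le
      have e2 := Real.sq_sqrt hb0.le
      calc _ = √a ^ 2 * b ^ 2 + a ^ 2 * √b ^ 2 + 2 * (a * b) * (√a * √b) := by ring
        _ = _ := by rw [e1, e2]; ring
    rw [mul_pow, h1]
    have h2 : 0 ≤ K ^ 2 * (a * b * (2 * (√a * √b))) := by positivity
    nlinarith

/-- The factorized tails sum to the square of a generating function. Zero vectors satisfy the
inequality trivially, and leaving them out produces the -1 that makes the bound small. -/
theorem IsStdGaussianMatrix.sign_fail (h : IsStdGaussianMatrix μ G) {K : ℝ} (hK : 0 ≤ K) :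
    μ.real {ω | ¬ ∀ z z' : Fin n → ℤ, (∀ i, |z i| ≤ 1) → (∀ i, |z' i| ≤ 1) →
      |bil (G ω) (fun i => z i) (fun i => z' i)| ≤
        K * (√(suppCard z) * suppCard z' + suppCard z * √(suppCard z'))} ≤
      2 * ((1 + 2 * Real.exp (-K ^ 2 / 2)) ^ n - 1) ^ 2 := by
  have := h.indep.isProbabilityMeasure
  set r := Real.exp (-K ^ 2 / 2) with hr
  set F := (Fintype.piFinset fun _ : Fin n => Finset.Icc (-((1 : ℕ) : ℤ)) ((1 : ℕ) : ℤ)).filter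
    fun z => 1 ≤ suppCard z with hF
  have hzero : ∀ z : Fin n → ℤ, ¬ 1 ≤ suppCard z ↔ z = 0 := fun z => by
    simp [suppCard, Finset.filter_eq_empty_iff, funext_iff]
  have hFsum : ∑ z ∈ F, r ^ suppCard z = (1 + 2 * r) ^ n - 1 := by
    have h1 := sum_pow_suppCard n 1 r
    rw [← Finset.sum_filter_add_sum_filter_not _ fun z => 1 ≤ suppCard z] at h1
    have h2 : (Fintype.piFinset fun _ : Fin n => Finset.Icc (-((1 : ℕ) : ℤ)) ((1 : ℕ) : ℤ)).filter
        (fun z => ¬ 1 ≤ suppCard z) = {0} := by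
      ext z
      rw [Finset.mem_filter, hzero, Finset.mem_singleton]
      refine ⟨fun h => h.2, fun h => ⟨?_, h⟩⟩
      subst h
      simp
    rw [h2, Finset.sum_singleton] at h1
    have h3 : suppCard (0 : Fin n → ℤ) = 0 := by simp [suppCard]
    rw [h3] at h1
    rw [pow_zero] at h1
    rw [hF, eq_sub_of_add_eq h1]
    simp
  have hcover : {ω | ¬ ∀ z z' : Fin n → ℤ, (∀ i, |z i| ≤ 1) → (∀ i, |z' i| ≤ 1) →
      |bil (G ω) (fun i => z i) (fun i => z' i)| ≤
        K * (√(suppCard z) * suppCard z' + suppCard z * √(suppCard z'))} ⊆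
      ⋃ zz ∈ F ×ˢ F, {ω | K * (√(suppCard zz.1) * suppCard zz.2 + suppCard zz.1 * √(suppCard zz.2)) <
      |bil (G ω) (fun i => zz.1 i) (fun i => zz.2 i)|} := by
    intro ω hω
    simp only [Set.mem_ofPred_eq] at hω
    push Not at hω
    obtain ⟨z, z', hz, hz', hlt⟩ := hω
    have hmem : ∀ z : Fin n → ℤ, (∀ i, |z i| ≤ 1) → z ≠ 0 → z ∈ F := fun z hz h0 => by
      rw [hF, Finset.mem_filter, Fintype.mem_piFinset]
      refine ⟨fun i => Finset.mem_Icc.2 ?_, not_not.1 (mt (hzero z).1 h0)⟩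
      simpa using abs_le.1 (hz i)
    have h0 : z ≠ 0 := fun h => by simp [h, bil, suppCard] at hlt
    have h0' : z' ≠ 0 := fun h => by simp [h, bil, suppCard] at hlt
    simp only [Set.mem_iUnion]
    exact ⟨(z, z'), Finset.mem_product.2 ⟨hmem z hz h0, hmem z' hz' h0'⟩, hlt⟩
  refine (measureReal_mono hcover (measure_ne_top _ _)).trans ((measureReal_biUnion_finset_le _ _).trans ?_)
  have hFle : ∀ z ∈ F, (∀ i, |z i| ≤ 1) ∧ 1 ≤ suppCard z := fun z hz => by
    rw [hF, Finset.mem_filter, Fintype.mem_piFinset] at hz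
    exact ⟨fun i => abs_le.2 (by simpa using hz.1 i), hz.2⟩
  calc _ ≤ ∑ zz ∈ F ×ˢ F, 2 * (r ^ suppCard zz.1 * r ^ suppCard zz.2) := by
        refine Finset.sum_le_sum fun zz hzz => ?_
        obtain ⟨h1, h2⟩ := Finset.mem_product.1 hzz
        exact h.sign_tail hK (hFle _ h1).1 (hFle _ h2).1 (hFle _ h1).2 (hFle _ h2).2
    _ = 2 * ((∑ z ∈ F, r ^ suppCard z) * ∑ z ∈ F, r ^ suppCard z) := by
        rw [← Finset.mul_sum, Finset.sum_product, Finset.sum_mul_sum]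
    _ = _ := by rw [hFsum]; ring

/-- With b = 2Nn, every counted vector has weight b^(k - support size) ≥ 1; summing this weight over
the whole cube gives b^k (1 + 1/n)^n ≤ e b^k. -/
theorem card_grid_le {N k : ℕ} (hn : 1 ≤ n) (hN : 1 ≤ N) :
    ((((Fintype.piFinset fun _ : Fin n => Finset.Icc (-(N : ℤ)) N).filter
      fun z => suppCard z ≤ k).card : ℕ) : ℝ) ≤ Real.exp 1 * (2 * N * n) ^ k := by
  have hn0 : (0 : ℝ) < n := by exact_mod_cast hn
  have hN0 : (0 : ℝ) < N := by exact_mod_cast hN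
  have hn1 : (1 : ℝ) ≤ n := by exact_mod_cast hn
  have hN1 : (1 : ℝ) ≤ N := by exact_mod_cast hN
  set b : ℝ := 2 * N * n with hb
  have hb0 : 0 < b := by positivity
  have hb1 : 1 ≤ b := by nlinarith
  rw [Finset.cast_card]
  calc _ ≤ ∑ z ∈ (Fintype.piFinset fun _ : Fin n => Finset.Icc (-(N : ℤ)) N).filter
        (fun z => suppCard z ≤ k), b ^ k * b⁻¹ ^ suppCard z := by
        refine Finset.sum_le_sum fun z hz => ?_
        have h1 := (Finset.mem_filter.1 hz).2
        rw [inv_pow, ← div_eq_mul_inv, one_le_div (by positivity)]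
        exact pow_le_pow_right₀ hb1 h1
    _ ≤ ∑ z ∈ Fintype.piFinset fun _ : Fin n => Finset.Icc (-(N : ℤ)) N,
        b ^ k * b⁻¹ ^ suppCard z :=
        Finset.sum_le_sum_of_subset_of_nonneg (Finset.filter_subset _ _)
          fun z _ _ => by positivity
    _ = b ^ k * (1 + (n : ℝ)⁻¹) ^ n := by
        rw [← Finset.mul_sum, sum_pow_suppCard]
        congr 3
        rw [hb]
        field_simp
    _ ≤ b ^ k * Real.exp 1 := by
        gcongr
        calc (1 + (n : ℝ)⁻¹) ^ n ≤ Real.exp (n : ℝ)⁻¹ ^ n := by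
              gcongr
              rw [add_comm]
              exact Real.add_one_le_exp _
          _ = Real.exp 1 := by rw [← Real.exp_nat_mul, mul_inv_cancel₀ hn0.ne']
    _ = _ := mul_comm _ _

theorem IsStdGaussianMatrix.goodMatrix_fail (h : IsStdGaussianMatrix μ G) {q : ℝ} (hq : 0 < q)
    {T ε K : ℝ} (hT : 0 < T) (hε : 0 ≤ ε) (hK : 0 ≤ K) (hn : 1 ≤ n) {N k : ℕ} (hN : 1 ≤ N) :
    μ.real {ω | ¬ GoodMatrix q K (n * (gaussMoment q + ε)) N k (G ω)} ≤
      2 * ((1 + 2 * Real.exp (-K ^ 2 / 2)) ^ n - 1) ^ 2 +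
      Real.exp 1 * (2 * N * n) ^ k *
        (2 * n * Real.exp (-T ^ 2 / 2) + Real.exp (-(2 * n * ε ^ 2) / (T ^ q) ^ 2)) := by
  have := h.indep.isProbabilityMeasure
  set F := (Fintype.piFinset fun _ : Fin n => Finset.Icc (-(N : ℤ)) N).filter
      fun z => suppCard z ≤ k with hF
  have hcover : {ω | ¬ GoodMatrix q K (n * (gaussMoment q + ε)) N k (G ω)} ⊆
      {ω | ¬ ∀ z z' : Fin n → ℤ, (∀ i, |z i| ≤ 1) → (∀ i, |z' i| ≤ 1) →
      |bil (G ω) (fun i => z i) (fun i => z' i)| ≤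
        K * (√(suppCard z) * suppCard z' + suppCard z * √(suppCard z'))} ∪
      ⋃ z ∈ F, {ω | (√2 * √(∑ i, (z i : ℝ) ^ 2)) ^ q * (n * (gaussMoment q + ε)) <
      ∑ j ∈ Finset.univ.filter (fun j => z j = 0), |∑ i, (G ω j i + G ω i j) * z i| ^ q} := by
    intro ω hω
    by_contra hcon
    rw [Set.mem_union, not_or] at hcon
    obtain ⟨h1, h2⟩ := hcon
    simp only [Set.mem_ofPred_eq, not_not, Set.mem_iUnion, not_exists, not_lt] at hω h1 h2
    refine hω ⟨h1, fun z hz hzk => ?_⟩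
    refine h2 z ?_
    rw [hF, Finset.mem_filter, Fintype.mem_piFinset]
    exact ⟨fun i => Finset.mem_Icc.2 (abs_le.1 (hz i)), hzk⟩
  refine (measureReal_mono hcover (measure_ne_top _ _)).trans ((measureReal_union_le _ _).trans
    (add_le_add (h.sign_fail hK) ((measureReal_biUnion_finset_le _ _).trans ?_)))
  calc _ ≤ ∑ z ∈ F, (2 * n * Real.exp (-T ^ 2 / 2) +
        Real.exp (-(2 * n * ε ^ 2) / (T ^ q) ^ 2)) :=
        Finset.sum_le_sum fun z _ => h.grid_tail hq hT hε z
    _ = F.card * (2 * n * Real.exp (-T ^ 2 / 2) +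
        Real.exp (-(2 * n * ε ^ 2) / (T ^ q) ^ 2)) := by
        rw [Finset.sum_const, nsmul_eq_mul]
    _ ≤ _ := by
        gcongr
        exact card_grid_le hn hN

end GaussianMatrix

/-! ### Borel–Cantelli and the choice of parameters -/

section Asymptotics

/-- The summable half of Borel–Cantelli needs no independence, so the joint law for different n is
irrelevant. -/
theorem ae_eventually_notMem_of_measureReal_le {Ω : Type*} [MeasurableSpace Ω] {μ : Measure Ω}
    [IsProbabilityMeasure μ] {E : ℕ → Set Ω} {C : ℝ}
    (h : ∀ᶠ n : ℕ in atTop, μ.real (E n) ≤ C * (n : ℝ) ^ (-2 : ℝ)) :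
    ∀ᵐ ω ∂μ, ∀ᶠ n in atTop, ω ∉ E n := by
  refine ae_eventually_notMem ?_
  have hs : Summable fun n : ℕ => C * (n : ℝ) ^ (-2 : ℝ) :=
    (Real.summable_nat_rpow.2 (by norm_num)).mul_left C
  have hs' : Summable fun n => μ.real (E n) := by
    refine hs.of_norm_bounded_eventually_nat ?_
    filter_upwards [h] with n hn
    rwa [Real.norm_of_nonneg measureReal_nonneg]
  have h1 : ∀ n, μ (E n) = ENNReal.ofReal (μ.real (E n)) := fun n =>
    (ofReal_measureReal (measure_ne_top _ _)).symm
  simp only [h1]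
  exact hs'.tsum_ofReal_ne_top

theorem eventually_log_le {a c : ℝ} (ha : 0 < a) (hc : 0 < c) :
    ∀ᶠ n : ℕ in atTop, Real.log n ≤ c * (n : ℝ) ^ a := by
  have h := (isLittleO_log_rpow_atTop ha).bound hc
  filter_upwards [tendsto_natCast_atTop_atTop.eventually h, eventually_ge_atTop 1] with n hn hn1
  have h1 : (1 : ℝ) ≤ n := by exact_mod_cast hn1
  rwa [Real.norm_of_nonneg (Real.log_nonneg h1), Real.norm_of_nonneg (by positivity)] at hn

theorem tendsto_natCast_rpow_neg {a : ℝ} (ha : 0 < a) :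
    Tendsto (fun n : ℕ => (n : ℝ) ^ (-a)) atTop (𝓝 0) :=
  (tendsto_rpow_neg_atTop ha).comp tendsto_natCast_atTop_atTop

theorem tendsto_sqrt_log_mul_rpow_neg {a c : ℝ} (ha : 0 < a) (hc : 0 ≤ c) :
    Tendsto (fun n : ℕ => √(c * Real.log n) * (n : ℝ) ^ (-a)) atTop (𝓝 0) := by
  have h1 : Tendsto (fun n : ℕ => √c * (n : ℝ) ^ (-(a / 2))) atTop (𝓝 0) := by
    simpa using (tendsto_natCast_rpow_neg (half_pos ha)).const_mul √c
  refine tendsto_of_tendsto_of_tendsto_of_le_of_le' tendsto_const_nhds h1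
    (Eventually.of_forall fun n => by positivity) ?_
  filter_upwards [eventually_log_le ha one_pos, eventually_ge_atTop 1] with n hn hn1
  have h0 : (0 : ℝ) < n := by exact_mod_cast hn1
  have h2 : √(Real.log n) ≤ (n : ℝ) ^ (a / 2) := by
    rw [Real.sqrt_le_left (by positivity), ← Real.rpow_natCast, ← Real.rpow_mul h0.le]
    norm_num
    linarith
  calc _ = √c * (√(Real.log n) * (n : ℝ) ^ (-a)) := by rw [Real.sqrt_mul hc, mul_assoc]
    _ ≤ √c * ((n : ℝ) ^ (a / 2) * (n : ℝ) ^ (-a)) := by gcongr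
    _ = _ := by
        rw [← Real.rpow_add h0]
        ring_nf

/-- The choice K = √(6 log n) makes the base weight n^(-3), so the generating function minus one is
O(n^(-2)); its square is even O(n^(-4)). -/
theorem sign_fail_bound {n : ℕ} (hn : 2 ≤ n) :
    2 * ((1 + 2 * Real.exp (-√(6 * Real.log n) ^ 2 / 2)) ^ n - 1) ^ 2 ≤
      32 * (n : ℝ) ^ (-2 : ℝ) := by
  have hn2 : (2 : ℝ) ≤ n := by exact_mod_cast hn
  have hn0 : (0 : ℝ) < n := by linarith
  have hlog : 0 ≤ Real.log n := Real.log_nonneg (by linarith)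
  have hr : Real.exp (-√(6 * Real.log n) ^ 2 / 2) = ((n : ℝ) ^ 3)⁻¹ := by
    rw [Real.sq_sqrt (by positivity), show -(6 * Real.log n) / 2 = -((3 : ℕ) * Real.log n) by
      push_cast; ring, Real.exp_neg, Real.exp_nat_mul, Real.exp_log hn0]
  rw [hr]
  set x : ℝ := 2 * ((n : ℝ) ^ 2)⁻¹ with hx
  have hx1 : x ≤ 1 := by
    rw [hx, ← div_eq_mul_inv, div_le_one (by positivity)]
    nlinarith
  have hx0 : 0 ≤ x := by positivity
  have h1 : (1 + 2 * ((n : ℝ) ^ 3)⁻¹) ^ n ≤ Real.exp x := by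
    calc (1 + 2 * ((n : ℝ) ^ 3)⁻¹) ^ n ≤ Real.exp (2 * ((n : ℝ) ^ 3)⁻¹) ^ n := by
          gcongr
          rw [add_comm]
          exact Real.add_one_le_exp _
      _ = Real.exp x := by
          rw [← Real.exp_nat_mul]
          congr 1
          rw [hx]
          field_simp
  have h2 : 1 ≤ (1 + 2 * ((n : ℝ) ^ 3)⁻¹) ^ n := one_le_pow₀ (by
    have : 0 ≤ ((n : ℝ) ^ 3)⁻¹ := by positivity
    linarith)
  have h3 : Real.exp x - 1 ≤ 2 * x := by
    have := Real.abs_exp_sub_one_le (x := x) (by rwa [abs_of_nonneg hx0])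
    rw [abs_of_nonneg hx0] at this
    exact (le_abs_self _).trans this
  have h4 : ((1 + 2 * ((n : ℝ) ^ 3)⁻¹) ^ n - 1) ^ 2 ≤ (2 * x) ^ 2 := by
    gcongr
    linarith
  have h5 : (n : ℝ) ^ (-2 : ℝ) = ((n : ℝ) ^ 2)⁻¹ := by
    rw [Real.rpow_neg hn0.le]
    norm_cast
  have h6 : ((n : ℝ) ^ 2)⁻¹ ≤ 1 := inv_le_one_of_one_le₀ (by nlinarith)
  have h7 : 0 < ((n : ℝ) ^ 2)⁻¹ := by positivity
  rw [h5]
  rw [hx] at h4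
  nlinarith

/-- With s = 1/(8q), T = n^s and ε = n^(-1/8), the Hoeffding exponent is 2√n and exceeds T²/2 =
n^(2s)/2. The grid has logarithmic size of order n^s log n, which n^(2s) beats. -/
theorem grid_fail_bound {q : ℝ} (hq : 2 < q) :
    ∀ᶠ n : ℕ in atTop,
      Real.exp 1 * (2 * n * n) ^ (⌈(n : ℝ) ^ (1 / (8 * q))⌉₊) *
        (2 * n * Real.exp (-((n : ℝ) ^ (1 / (8 * q))) ^ 2 / 2) +
          Real.exp (-(2 * n * ((n : ℝ) ^ (-(1 / 8 : ℝ))) ^ 2) /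
            (((n : ℝ) ^ (1 / (8 * q))) ^ q) ^ 2)) ≤ (n : ℝ) ^ (-2 : ℝ) := by
  set s := 1 / (8 * q) with hs
  have hs0 : 0 < s := by positivity
  -- The constant 1/22 gives y²/2 ≥ 11 y l ≥ 6 y l + 5 l, precisely what the last exponent
  -- comparison needs.
  filter_upwards [eventually_log_le hs0 (by norm_num : (0 : ℝ) < 1 / 22),
    eventually_ge_atTop 3] with n hlog hn
  have hn3 : (3 : ℝ) ≤ n := by exact_mod_cast hn
  have hn0 : (0 : ℝ) < n := by linarith
  set l := Real.log n with hl
  set y := (n : ℝ) ^ s with hy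
  have hy1 : 1 ≤ y := Real.one_le_rpow (by linarith) hs0.le
  have hl1 : 1 ≤ l := by
    rw [hl, Real.le_log_iff_exp_le hn0]
    exact Real.exp_one_lt_d9.le.trans (by linarith)
  have hexp : Real.exp l = n := Real.exp_log hn0
  have hyq : (y ^ q) ^ 2 = (n : ℝ) ^ (1 / 4 : ℝ) := by
    rw [hy, ← Real.rpow_mul hn0.le, ← Real.rpow_natCast, ← Real.rpow_mul hn0.le]
    congr 1
    rw [hs]
    push_cast
    field_simp
    norm_num
  have hε : ((n : ℝ) ^ (-(1 / 8 : ℝ))) ^ 2 = (n : ℝ) ^ (-(1 / 4) : ℝ) := by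
    rw [← Real.rpow_natCast, ← Real.rpow_mul hn0.le]
    norm_num
  have h1 : Real.exp (-(2 * n * ((n : ℝ) ^ (-(1 / 8 : ℝ))) ^ 2) / (y ^ q) ^ 2) ≤
      Real.exp (-y ^ 2 / 2) := by
    rw [hyq, hε, Real.exp_le_exp, neg_div, neg_div, neg_le_neg_iff]
    have e1 : 2 * (n : ℝ) * (n : ℝ) ^ (-(1 / 4) : ℝ) / (n : ℝ) ^ (1 / 4 : ℝ) =
        2 * (n : ℝ) ^ (1 / 2 : ℝ) := by
      rw [mul_assoc, mul_div_assoc]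
      congr 1
      nth_rewrite 1 [← Real.rpow_one (n : ℝ)]
      rw [← Real.rpow_add hn0, ← Real.rpow_sub hn0]
      norm_num
    have e2 : y ^ 2 ≤ (n : ℝ) ^ (1 / 2 : ℝ) := by
      rw [hy, ← Real.rpow_natCast, ← Real.rpow_mul hn0.le]
      refine Real.rpow_le_rpow_of_exponent_le (by linarith) ?_
      rw [hs]
      push_cast
      rw [div_mul_eq_mul_div, div_le_div_iff₀ (by positivity) (by norm_num)]
      linarith
    rw [e1]
    have : 0 < y ^ 2 := by positivity
    linarith
  have hk : ((⌈y⌉₊ : ℕ) : ℝ) ≤ 2 * y := by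
    have := (Nat.ceil_lt_add_one (by positivity : 0 ≤ y)).le
    linarith
  have h2 : (2 * (n : ℝ) * n) ^ ⌈y⌉₊ ≤ Real.exp (6 * y * l) := by
    calc (2 * (n : ℝ) * n) ^ ⌈y⌉₊ ≤ (Real.exp (3 * l)) ^ ⌈y⌉₊ := by
          gcongr
          rw [show 3 * l = l + l + l by ring, Real.exp_add, Real.exp_add, hexp]
          have : 0 < (n : ℝ) * n := by positivity
          nlinarith
      _ = Real.exp (⌈y⌉₊ * (3 * l)) := (Real.exp_nat_mul _ _).symm
      _ ≤ _ := by
          rw [Real.exp_le_exp]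
          nlinarith
  have h3 : 2 * (n : ℝ) + 1 ≤ Real.exp (2 * l) := by
    rw [show 2 * l = l + l by ring, Real.exp_add, hexp]
    nlinarith
  calc _ ≤ Real.exp l * Real.exp (6 * y * l) *
        (2 * n * Real.exp (-y ^ 2 / 2) + Real.exp (-y ^ 2 / 2)) := by gcongr
    _ = Real.exp l * Real.exp (6 * y * l) * ((2 * n + 1) * Real.exp (-y ^ 2 / 2)) := by ring
    _ ≤ Real.exp l * Real.exp (6 * y * l) * (Real.exp (2 * l) * Real.exp (-y ^ 2 / 2)) := by
        gcongr
    _ = Real.exp (l + 6 * y * l + (2 * l + -y ^ 2 / 2)) := by simp only [Real.exp_add]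
    _ ≤ Real.exp (l * (-2)) := by
        rw [Real.exp_le_exp]
        nlinarith
    _ = _ := by rw [hl, Real.rpow_def_of_pos hn0]

end Asymptotics

/-! ### The almost sure upper bound -/

section Max

variable {p q : ℝ}

theorem sum_abs_rpow_eq_one_of_mem_unitSphere (hp : 0 < p) {n : ℕ} {x : Fin n → ℝ}
    (hx : x ∈ unitSphere p n) : ∑ i, |x i| ^ p = 1 := by
  have hs : 0 ≤ ∑ i, |x i| ^ p := Finset.sum_nonneg fun i _ => by positivity
  have hx' : (∑ i, |x i| ^ p) ^ (1 / p) = 1 := hx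
  have := congrArg (fun t : ℝ => t ^ p) hx'
  simpa [← Real.rpow_mul hs, hp.ne'] using this

/-- The limiting upper bound for the scaled maximum. -/
noncomputable def upperSeq (p q : ℝ) (n : ℕ) : ℝ :=
  √2 * 2 ^ (-(2 / p)) * (gaussMoment q + (n : ℝ) ^ (-(1 / 8 : ℝ))) ^ (1 / q) +
    (8 * (√(6 * Real.log n) * (n : ℝ) ^ (-((1 - 2 * (1 / (8 * q))) / q))) +
    2 / (1 - p / 2) * (√(6 * Real.log n) * (n : ℝ) ^ (-(1 / (8 * q) / p * (1 - p / 2)))) +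
    8 * (√(6 * Real.log n) * (n : ℝ) ^ (-(1 - 1 / (8 * q)))))

theorem tendsto_upperSeq (hp : 0 < p) (hp2 : p < 2) (hq : 2 < q) :
    Tendsto (upperSeq p q) atTop (𝓝 (√2 * 2 ^ (-(2 / p)) * gaussMoment q ^ (1 / q))) := by
  have hq0 : 0 < q := by linarith
  have hs : 1 / (8 * q) < 1 / 16 := by
    rw [div_lt_div_iff₀ (by positivity) (by norm_num)]
    linarith
  have h1 := tendsto_sqrt_log_mul_rpow_neg (a := (1 - 2 * (1 / (8 * q))) / q) (c := 6)
    (div_pos (by linarith) hq0) (by norm_num)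
  have h2 := tendsto_sqrt_log_mul_rpow_neg (a := 1 / (8 * q) / p * (1 - p / 2)) (c := 6)
    (mul_pos (by positivity) (by linarith)) (by norm_num)
  have h3 := tendsto_sqrt_log_mul_rpow_neg (a := 1 - 1 / (8 * q)) (c := 6)
    (by linarith) (by norm_num)
  have h4 : Tendsto (fun n : ℕ => (gaussMoment q + (n : ℝ) ^ (-(1 / 8 : ℝ))) ^ (1 / q)) atTop
      (𝓝 (gaussMoment q ^ (1 / q))) := by
    have h5 : Tendsto (fun n : ℕ => gaussMoment q + (n : ℝ) ^ (-(1 / 8 : ℝ))) atTop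
        (𝓝 (gaussMoment q)) := by
      simpa using (tendsto_natCast_rpow_neg (a := 1 / 8) (by norm_num)).const_add (gaussMoment q)
    exact h5.rpow_const (Or.inl (gaussMoment_pos hq0.le).ne')
  have := (h4.const_mul (√2 * 2 ^ (-(2 / p)))).add
    (((h1.const_mul 8).add (h2.const_mul (2 / (1 - p / 2)))).add (h3.const_mul 8))
  simp only [mul_zero, add_zero] at this
  exact this

/-- Here the grid mesh is 1/n and k = ⌈n^s⌉ with s = 1/(8q); after division by n^(1/q) every term
but the first is √log n times a negative power of n. -/
theorem GoodMatrix.maxForm_le {n : ℕ} (hn : 1 ≤ n) (hpq : p.HolderConjugate q) (hp2 : p < 2)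
    {A : Matrix (Fin n) (Fin n) ℝ}
    (h : GoodMatrix q √(6 * Real.log n) (n * (gaussMoment q + (n : ℝ) ^ (-(1 / 8 : ℝ)))) n
      ⌈(n : ℝ) ^ (1 / (8 * q))⌉₊ A) :
    maxForm p A ≤ (n : ℝ) ^ (1 / q) * upperSeq p q n := by
  have hp := hpq.pos
  have hq := hpq.symm.pos
  obtain ⟨x, hx, hxm⟩ := (isGreatest_maxForm hpq.lt.le hn A).1
  rw [← hxm]
  have hn1 : (1 : ℝ) ≤ n := by exact_mod_cast hn
  have hn0 : (0 : ℝ) < n := by linarith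
  have hm := gaussMoment_pos hq.le
  set s := 1 / (8 * q) with hs
  have hs0 : 0 < s := by positivity
  set y := (n : ℝ) ^ s with hy
  have hy1 : 1 ≤ y := Real.one_le_rpow (by linarith) hs0.le
  -- Chosen so that δ^(-p) = n^s, the quantity rounded up to k.
  set δ := (n : ℝ) ^ (-(s / p)) with hδ
  have hδ0 : 0 < δ := by positivity
  have hδp : δ ^ (-p) ≤ (⌈y⌉₊ : ℝ) := by
    refine le_of_eq_of_le ?_ (Nat.le_ceil y)
    rw [hδ, ← Real.rpow_mul hn0.le, hy]
    congr 1
    field_simp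
  have hk : ((⌈y⌉₊ : ℕ) : ℝ) ≤ 2 * y := by
    have := (Nat.ceil_lt_add_one (by positivity : 0 ≤ y)).le
    linarith
  set K := √(6 * Real.log n) with hK
  have hε : 0 ≤ (n : ℝ) ^ (-(1 / 8 : ℝ)) := by positivity
  refine (h.quadForm_le (by positivity) hn hn hpq hp2 hδ0 hδp
    (sum_abs_rpow_eq_one_of_mem_unitSphere hp hx)).trans ?_
  have e1 : (n * (gaussMoment q + (n : ℝ) ^ (-(1 / 8 : ℝ)))) ^ (1 / q) =
      (n : ℝ) ^ (1 / q) * (gaussMoment q + (n : ℝ) ^ (-(1 / 8 : ℝ))) ^ (1 / q) :=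
    Real.mul_rpow hn0.le (by positivity)
  have e2 : (((⌈y⌉₊ : ℕ) : ℝ) ^ (1 / q)) ^ 2 ≤
      (n : ℝ) ^ (1 / q) * (4 * (n : ℝ) ^ (-((1 - 2 * s) / q))) := by
    have h1 : ((⌈y⌉₊ : ℕ) : ℝ) ^ (1 / q) ≤ 2 * y ^ (1 / q) := by
      calc ((⌈y⌉₊ : ℕ) : ℝ) ^ (1 / q) ≤ (2 * y) ^ (1 / q) := by gcongr
        _ = 2 ^ (1 / q) * y ^ (1 / q) := Real.mul_rpow (by norm_num) (by positivity)
        _ ≤ 2 * y ^ (1 / q) := by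
            gcongr
            refine (Real.rpow_le_rpow_of_exponent_le (by norm_num)
              (?_ : 1 / q ≤ 1)).trans_eq (Real.rpow_one _)
            rw [div_le_one hq]
            exact hpq.symm.lt.le
    calc (((⌈y⌉₊ : ℕ) : ℝ) ^ (1 / q)) ^ 2 ≤ (2 * y ^ (1 / q)) ^ 2 := by gcongr
      _ = 4 * (y ^ (1 / q)) ^ 2 := by ring
      _ = 4 * (n : ℝ) ^ (1 / q + -((1 - 2 * s) / q)) := by
          rw [hy, ← Real.rpow_mul hn0.le, ← Real.rpow_natCast, ← Real.rpow_mul hn0.le]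
          congr 2
          push_cast
          ring
      _ = _ := by
          rw [Real.rpow_add hn0]
          ring
  have e3 : δ ^ (1 - p / 2) = (n : ℝ) ^ (-(s / p * (1 - p / 2))) := by
    rw [hδ, ← Real.rpow_mul hn0.le]
    congr 1
    ring
  have e4 : ((⌈y⌉₊ : ℕ) : ℝ) / n ≤ 2 * (n : ℝ) ^ (-(1 - s)) := by
    calc ((⌈y⌉₊ : ℕ) : ℝ) / n ≤ 2 * y / n := by gcongr
      _ = _ := by
        rw [mul_div_assoc, hy]
        congr 1
        nth_rewrite 2 [← Real.rpow_one (n : ℝ)]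
        rw [← Real.rpow_sub hn0]
        congr 1
        ring
  unfold upperSeq
  rw [← hs, ← hK, e1, e3]
  have hK0 : 0 ≤ K := Real.sqrt_nonneg _
  have t2 := mul_le_mul_of_nonneg_left e2 (by positivity : 0 ≤ 2 * K)
  have t4 := mul_le_mul_of_nonneg_left e4
    (by positivity : 0 ≤ 4 * K * (n : ℝ) ^ (1 / q))
  calc _ ≤ √2 * 2 ^ (-(2 / p)) *
        ((n : ℝ) ^ (1 / q) * (gaussMoment q + (n : ℝ) ^ (-(1 / 8 : ℝ))) ^ (1 / q)) +
        2 * K * ((n : ℝ) ^ (1 / q) * (4 * (n : ℝ) ^ (-((1 - 2 * s) / q)))) +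
        2 * K * ((n : ℝ) ^ (-(s / p * (1 - p / 2))) / (1 - p / 2)) * (n : ℝ) ^ (1 / q) +
        4 * K * (n : ℝ) ^ (1 / q) * (2 * (n : ℝ) ^ (-(1 - s))) := by linarith
    _ = _ := by ring

/-- Almost surely, the scaled maximum is eventually at most `upperSeq`. -/
theorem ae_eventually_maxForm_le {Ω : Type*} [MeasurableSpace Ω] {μ : Measure Ω}
    [IsProbabilityMeasure μ] {G : (n : ℕ) → Ω → Matrix (Fin n) (Fin n) ℝ}
    (hG : ∀ n, IsStdGaussianMatrix μ (G n)) (hpq : p.HolderConjugate q) (hp2 : p < 2)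
    (hq : 2 < q) :
    ∀ᵐ ω ∂μ, ∀ᶠ n in atTop, maxForm p (G n ω) ≤ (n : ℝ) ^ (1 / q) * upperSeq p q n := by
  -- The constant is 32 for the sign vectors plus 1 for the grid.
  have h : ∀ᶠ n : ℕ in atTop, μ.real {ω | ¬ GoodMatrix q √(6 * Real.log n)
      (n * (gaussMoment q + (n : ℝ) ^ (-(1 / 8 : ℝ)))) n ⌈(n : ℝ) ^ (1 / (8 * q))⌉₊ (G n ω)} ≤
      33 * (n : ℝ) ^ (-2 : ℝ) := by
    filter_upwards [grid_fail_bound hq, eventually_ge_atTop 2] with n h1 h2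
    have hn0 : (0 : ℝ) < n := by exact_mod_cast (by omega : 0 < n)
    refine ((hG n).goodMatrix_fail (by linarith) (T := (n : ℝ) ^ (1 / (8 * q))) (by positivity)
      (by positivity) (by positivity) (by omega) (by omega)).trans ?_
    linarith [sign_fail_bound h2]
  filter_upwards [ae_eventually_notMem_of_measureReal_le h] with ω hω
  filter_upwards [hω, eventually_ge_atTop 1] with n hn hn1
  exact GoodMatrix.maxForm_le hn1 hpq hp2 (not_not.1 hn)

end Max

/-! ### Gaussian sums with coefficients depending on other coordinates -/

/-- The coordinates in S are independent of the remaining ones, so the joint law is a product. On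
each slice the coefficients are constants and the ordinary tail holds uniformly; Fubini integrates
it. -/
theorem IsStdGaussianFamily.conditional_tail {Ω ι : Type*} [MeasurableSpace Ω] {μ : Measure Ω}
    {X : ι → Ω → ℝ} [Fintype ι] [DecidableEq ι] (h : IsStdGaussianFamily μ X) (S : Finset ι)
    {c : (S → ℝ) → ι → ℝ} (hc : ∀ t, Measurable fun y => c y t)
    (hc1 : ∀ y, ∑ t : ↥(Sᶜ), c y t ^ 2 ≤ 1) {a : ℝ} (ha : 0 ≤ a) :
    μ.real {ω | a ≤ |∑ t : ↥(Sᶜ), c (fun s : S => X s ω) t * X t ω|} ≤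
      2 * Real.exp (-a ^ 2 / 2) := by
  have := h.indep.isProbabilityMeasure
  have hY : Measurable fun ω (s : S) => X s ω := measurable_pi_lambda _ fun s => h.measurable s
  have hZ : Measurable fun ω (t : ↥(Sᶜ)) => X t ω := measurable_pi_lambda _ fun s => h.measurable s
  have hI := h.indep.indepFun_finset S Sᶜ disjoint_compl_right h.measurable
  have hmap := (indepFun_iff_map_prod_eq_prod_map_map hY.aemeasurable hZ.aemeasurable).1 hI
  set E : Set ((S → ℝ) × (↥(Sᶜ) → ℝ)) := {yz | a ≤ |∑ t : ↥(Sᶜ), c yz.1 t * yz.2 t|} with hE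
  have hEm : MeasurableSet E := by
    refine measurableSet_le measurable_const (Measurable.abs ?_)
    refine Finset.measurable_fun_sum _ fun t _ => ?_
    exact ((hc t).comp measurable_fst).mul ((measurable_pi_apply t).comp measurable_snd)
  have hfam : IsStdGaussianFamily μ fun t : ↥(Sᶜ) => X t :=
    ⟨fun t => h.measurable t, fun t => h.law t, h.indep.precomp Subtype.val_injective⟩
  have hslice : ∀ y, (μ.map fun ω (t : ↥(Sᶜ)) => X t ω) (Prod.mk y ⁻¹' E) ≤
      ENNReal.ofReal (2 * Real.exp (-a ^ 2 / 2)) := by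
    intro y
    rw [Measure.map_apply hZ (measurable_prodMk_left hEm)]
    have h1 := hfam.abs_sum_tail (c := fun t => c y t) (v := 1) (hc1 y) ha
    rw [mul_one] at h1
    rw [← ofReal_measureReal (measure_ne_top _ _)]
    exact ENNReal.ofReal_le_ofReal h1
  have hle : μ {ω | a ≤ |∑ t : ↥(Sᶜ), c (fun s : S => X s ω) t * X t ω|} ≤
      ENNReal.ofReal (2 * Real.exp (-a ^ 2 / 2)) := by
    have e1 : {ω | a ≤ |∑ t : ↥(Sᶜ), c (fun s : S => X s ω) t * X t ω|} =
        (fun ω => ((fun s : S => X s ω), fun t : ↥(Sᶜ) => X t ω)) ⁻¹' E := rfl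
    rw [e1, ← Measure.map_apply (hY.prodMk hZ) hEm, hmap, Measure.prod_apply hEm]
    have : IsProbabilityMeasure (μ.map fun ω (s : S) => X s ω) :=
      Measure.isProbabilityMeasure_map hY.aemeasurable
    refine (lintegral_mono hslice).trans ?_
    simp
  exact ENNReal.toReal_le_of_le_ofReal (by positivity) hle

/-! ### The explicit vectors: deterministic estimates -/

section OptVec

variable {n : ℕ} {p q : ℝ}

theorem symMatrix_apply (A : Matrix (Fin n) (Fin n) ℝ) (i j : Fin n) :
    symMatrix A i j = (√2)⁻¹ * (A i j + A j i) := rfl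

/-- The sum `∑ j, |B i j| ^ q` for the symmetrized matrix `B`. -/
noncomputable def rowSum (q : ℝ) (A : Matrix (Fin n) (Fin n) ℝ) (i : Fin n) : ℝ :=
  ∑ j, |symMatrix A i j| ^ q

theorem rowSum_nonneg (A : Matrix (Fin n) (Fin n) ℝ) (i : Fin n) : 0 ≤ rowSum q A i :=
  Finset.sum_nonneg fun j _ => by positivity

theorem normP_rpow (hp : 0 < p) (x : Fin n → ℝ) : normP p x ^ p = ∑ i, |x i| ^ p := by
  unfold normP
  rw [← Real.rpow_mul (Finset.sum_nonneg fun i _ => by positivity), one_div_mul_cancel hp.ne',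
    Real.rpow_one]

theorem symMatrix_mulVec_basisVec (A : Matrix (Fin n) (Fin n) ℝ) (i j : Fin n) :
    (symMatrix A *ᵥ basisVec i) j = symMatrix A i j := by
  simp [basisVec, symMatrix_apply, add_comm]

theorem optVec_apply (hpq : p.HolderConjugate q) (A : Matrix (Fin n) (Fin n) ℝ) (i j : Fin n) :
    optVec p A i j =
      sgn (symMatrix A i j) * (|symMatrix A i j| ^ q / rowSum q A i) ^ (1 / p) := by
  have hq : p.conjExponent = q := hpq.conjExponent_eq
  unfold optVec
  rw [hq, normP_rpow hpq.symm.pos]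
  simp only [symMatrix_mulVec_basisVec]
  rfl

theorem abs_sgn (a : ℝ) : |sgn a| = 1 := by
  unfold sgn
  split_ifs <;> simp

theorem mul_sgn (a : ℝ) : a * sgn a = |a| := by
  unfold sgn
  split_ifs with h
  · rw [mul_one, abs_of_nonneg h]
  · rw [abs_of_neg (not_le.1 h)]
    ring

theorem measurable_sgn : Measurable sgn :=
  Measurable.ite measurableSet_Ici measurable_const measurable_const

theorem abs_optVec_rpow (hpq : p.HolderConjugate q) (A : Matrix (Fin n) (Fin n) ℝ) (i j : Fin n) :
    |optVec p A i j| ^ p = |symMatrix A i j| ^ q / rowSum q A i := by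
  have h := rowSum_nonneg (q := q) A i
  rw [optVec_apply hpq, abs_mul, abs_sgn, one_mul, abs_of_nonneg (by positivity),
    ← Real.rpow_mul (by positivity), one_div_mul_cancel hpq.pos.ne', Real.rpow_one]

theorem sum_abs_optVec_rpow (hpq : p.HolderConjugate q) (A : Matrix (Fin n) (Fin n) ℝ)
    (i : Fin n) : ∑ j, |optVec p A i j| ^ p = rowSum q A i / rowSum q A i := by
  simp only [abs_optVec_rpow hpq]
  rw [← Finset.sum_div]
  rfl

/-- The vector `optVec p A i` with the `i`-th coordinate deleted. -/
noncomputable def offVec (p : ℝ) (A : Matrix (Fin n) (Fin n) ℝ) (i : Fin n) : Fin n → ℝ :=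
  fun j => if j = i then 0 else optVec p A i j

/-- The ℓ_2 norm is at most the ℓ_p norm, which is at most 1 also for a vanishing row, since then 0
/ 0 = 0. -/
theorem sum_offVec_sq_le (hpq : p.HolderConjugate q) (hp2 : p ≤ 2) (A : Matrix (Fin n) (Fin n) ℝ)
    (i : Fin n) : ∑ j, offVec p A i j ^ 2 ≤ 1 := by
  have hp := hpq.pos
  have h1 := sqrt_sum_sq_le Finset.univ hp hp2 (offVec p A i)
  have h2 : ∑ j, |offVec p A i j| ^ p ≤ 1 := by
    calc ∑ j, |offVec p A i j| ^ p ≤ ∑ j, |optVec p A i j| ^ p := by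
          refine Finset.sum_le_sum fun j _ => ?_
          unfold offVec
          split_ifs
          · simp only [abs_zero, Real.zero_rpow hp.ne']
            positivity
          · exact le_rfl
      _ ≤ 1 := by
          rw [sum_abs_optVec_rpow hpq]
          exact div_self_le_one _
  have h3 : √(∑ j, offVec p A i j ^ 2) ≤ 1 :=
    h1.trans (Real.rpow_le_one (Finset.sum_nonneg fun i _ => by positivity) h2 (by positivity))
  simpa using Real.sqrt_le_iff.1 h3

/-- Dependence on row and column i alone is what permits conditioning on them. -/
theorem optVec_congr {A A' : Matrix (Fin n) (Fin n) ℝ} {i : Fin n}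
    (h : ∀ j, A i j = A' i j ∧ A j i = A' j i) (hpq : p.HolderConjugate q) :
    optVec p A i = optVec p A' i := by
  have h1 : ∀ j, symMatrix A i j = symMatrix A' i j := fun j => by
    rw [symMatrix_apply, symMatrix_apply, (h j).1, (h j).2]
  ext j
  rw [optVec_apply hpq, optVec_apply hpq]
  simp only [rowSum, h1]

/-- Moving the i-th coordinate to the basis vector leaves a remainder whose own quadratic form
avoids row and column i. -/
theorem basisVec_add_optVec (A : Matrix (Fin n) (Fin n) ℝ) (i : Fin n) :
    basisVec i + optVec p A i = (1 + optVec p A i i) • basisVec i + offVec p A i := by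
  ext j
  by_cases h : j = i
  · subst h
    simp [basisVec, offVec]
  · simp [basisVec, offVec, h]

theorem rowSum_eq_add (A : Matrix (Fin n) (Fin n) ℝ) (i : Fin n) :
    rowSum q A i = |symMatrix A i i| ^ q +
      ∑ j ∈ Finset.univ.erase i, |symMatrix A i j| ^ q :=
  (Finset.add_sum_erase _ _ (Finset.mem_univ i)).symm

/-- Equality case of Hölder: as 1 + q/p = q, each product B_ij v_i(j) is |B_ij|^q S^(-1/p). Dropping
the diagonal term costs the fraction |v_i(i)|^p, and √2 comes from A + Aᵀ = √2 B. -/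
theorem bil_basisVec_offVec (hpq : p.HolderConjugate q) (A : Matrix (Fin n) (Fin n) ℝ)
    (i : Fin n) (hS : 0 < rowSum q A i) :
    bil A (basisVec i) (offVec p A i) + bil A (offVec p A i) (basisVec i) =
      √2 * (rowSum q A i ^ (1 / q) * (1 - |optVec p A i i| ^ p)) := by
  have hq := hpq.symm.pos
  have hp := hpq.pos
  set S := rowSum q A i with hSdef
  have hterm : ∀ j, symMatrix A i j * optVec p A i j = |symMatrix A i j| ^ q * S ^ (-(1 / p)) := by
    intro j
    rw [optVec_apply hpq, ← mul_assoc, mul_sgn, Real.div_rpow (by positivity) hS.le,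
      ← Real.rpow_mul (abs_nonneg _), Real.rpow_neg hS.le, ← div_eq_mul_inv, ← mul_div_assoc]
    congr 1
    rcases eq_or_ne (symMatrix A i j) 0 with h0 | h0
    · simp [h0, hq.ne']
    · have := abs_pos.2 h0
      nth_rewrite 1 [← Real.rpow_one |symMatrix A i j|]
      rw [← Real.rpow_add this]
      congr 1
      have h2 : q * (1 / p) = q - 1 := by
        have := hpq.inv_add_inv_eq_one
        field_simp at this ⊢
        linarith
      linarith
  have h1 : bil A (basisVec i) (offVec p A i) + bil A (offVec p A i) (basisVec i) =
      √2 * ∑ j, symMatrix A i j * offVec p A i j := by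
    rw [bil_eq_sum_right A (basisVec i), bil_eq_sum_left A (offVec p A i),
      ← Finset.sum_add_distrib, Finset.mul_sum]
    refine Finset.sum_congr rfl fun j _ => ?_
    simp only [basisVec, Pi.single_apply, mul_ite, mul_one, mul_zero, Finset.sum_ite_eq',
      Finset.mem_univ, if_true]
    rw [symMatrix_apply, ← mul_assoc, ← mul_assoc, mul_inv_cancel₀ (by positivity)]
    ring
  rw [h1]
  congr 1
  have h2 : ∑ j, symMatrix A i j * offVec p A i j =
      ∑ j ∈ Finset.univ.erase i, |symMatrix A i j| ^ q * S ^ (-(1 / p)) := by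
    rw [← Finset.add_sum_erase _ _ (Finset.mem_univ i)]
    have : offVec p A i i = 0 := by simp [offVec]
    rw [this, mul_zero, zero_add]
    refine Finset.sum_congr rfl fun j hj => ?_
    rw [← hterm]
    simp [offVec, Finset.ne_of_mem_erase hj]
  rw [h2, ← Finset.sum_mul, abs_optVec_rpow hpq, ← hSdef]
  have h3 := rowSum_eq_add (q := q) A i
  rw [← hSdef] at h3
  have h4 : ∑ j ∈ Finset.univ.erase i, |symMatrix A i j| ^ q = S - |symMatrix A i i| ^ q := by
    linarith
  have h5 : S ^ (1 / q) = S * S ^ (-(1 / p)) := by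
    nth_rewrite 2 [← Real.rpow_one S]
    rw [← Real.rpow_add hS]
    congr 1
    have := hpq.inv_add_inv_eq_one
    rw [one_div, one_div]
    linarith
  rw [h4, h5]
  field_simp

theorem sum_abs_basisVec_add_optVec (hpq : p.HolderConjugate q) (A : Matrix (Fin n) (Fin n) ℝ)
    (i : Fin n) (hS : 0 < rowSum q A i) :
    ∑ j, |(basisVec i + optVec p A i) j| ^ p =
      |1 + optVec p A i i| ^ p + (1 - |optVec p A i i| ^ p) := by
  rw [← Finset.add_sum_erase _ _ (Finset.mem_univ i)]
  congr 1
  · simp [basisVec]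
  · have h1 := sum_abs_optVec_rpow hpq A i
    rw [div_self hS.ne', ← Finset.add_sum_erase _ _ (Finset.mem_univ i)] at h1
    rw [← h1, add_sub_cancel_left]
    refine Finset.sum_congr rfl fun j hj => ?_
    simp [basisVec, Finset.ne_of_mem_erase hj]

/-- With t = |v_i(i)|, the p-th power D of the norm satisfies 1 ≤ D ≤ 2(1 + 3t/2). The lower bound
keeps normalization from amplifying errors; the upper one yields 2^(-2/p) up to a factor 1 - 3t. -/
theorem normP_basisVec_add_optVec_bounds (hpq : p.HolderConjugate q) (hp2 : p ≤ 2)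
    (A : Matrix (Fin n) (Fin n) ℝ) (i : Fin n) (hS : 0 < rowSum q A i)
    (ht : |optVec p A i i| ≤ 1 / 5) :
    (normP p (basisVec i + optVec p A i))⁻¹ ^ 2 ≤ 1 ∧
      2 ^ (-(2 / p)) * (1 - 3 * |optVec p A i i|) ≤
        (normP p (basisVec i + optVec p A i))⁻¹ ^ 2 := by
  have hp := hpq.pos
  have hp1 := hpq.lt
  set t := |optVec p A i i| with ht'
  have ht0 : 0 ≤ t := abs_nonneg _
  set D := ∑ j, |(basisVec i + optVec p A i) j| ^ p with hD
  have hDe := sum_abs_basisVec_add_optVec hpq A i hS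
  rw [← hD, ← ht'] at hDe
  have htp : t ^ p ≤ t := by
    simpa using Real.rpow_le_rpow_of_exponent_ge' ht0 (by linarith) zero_le_one hp1.le
  have htp0 : 0 ≤ t ^ p := by positivity
  have hb := abs_le.1 (le_of_eq ht'.symm : |optVec p A i i| ≤ t)
  have hpos : 0 < 1 + optVec p A i i := by linarith
  have hDl : 1 ≤ D := by
    have h1 : (1 - t) ^ 2 ≤ |1 + optVec p A i i| ^ p := by
      calc (1 - t) ^ 2 = (1 - t) ^ (2 : ℝ) := by norm_cast
        _ ≤ (1 - t) ^ p := Real.rpow_le_rpow_of_exponent_ge (by linarith) (by linarith) hp2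
        _ ≤ _ := by
            rw [abs_of_pos hpos]
            exact Real.rpow_le_rpow (by linarith) (by linarith) hp.le
    nlinarith
  have hDu : D ≤ 2 * (1 + 3 / 2 * t) := by
    have h1 : |1 + optVec p A i i| ^ p ≤ (1 + t) ^ 2 := by
      calc |1 + optVec p A i i| ^ p ≤ (1 + t) ^ p := by
            rw [abs_of_pos hpos]
            exact Real.rpow_le_rpow hpos.le (by linarith) hp.le
        _ ≤ (1 + t) ^ (2 : ℝ) := Real.rpow_le_rpow_of_exponent_le (by linarith) hp2
        _ = _ := by norm_cast
    nlinarith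
  have hD0 : 0 < D := by linarith
  have hN : (normP p (basisVec i + optVec p A i))⁻¹ ^ 2 = D ^ (-(2 / p)) := by
    unfold normP
    rw [← hD, ← Real.rpow_neg hD0.le, ← Real.rpow_natCast, ← Real.rpow_mul hD0.le]
    congr 1
    push_cast
    ring
  rw [hN]
  refine ⟨Real.rpow_le_one_of_one_le_of_nonpos hDl (by
    have : 0 < 2 / p := by positivity
    linarith), ?_⟩
  have h2 : 0 < 1 + 3 / 2 * t := by linarith
  calc 2 ^ (-(2 / p)) * (1 - 3 * t) ≤ 2 ^ (-(2 / p)) * (1 + 3 / 2 * t) ^ (-(2 / p)) := by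
        gcongr
        calc 1 - 3 * t ≤ (1 + 3 / 2 * t) ^ (-2 : ℝ) := by
              rw [Real.rpow_neg h2.le, ← one_div, le_div_iff₀ (by positivity)]
              norm_cast
              nlinarith [mul_nonneg ht0 ht0, mul_nonneg ht0 (mul_nonneg ht0 ht0)]
          _ ≤ _ := by
              refine Real.rpow_le_rpow_of_exponent_le (by linarith) ?_
              rw [neg_le_neg_iff, div_le_iff₀ hp]
              linarith
    _ = (2 * (1 + 3 / 2 * t)) ^ (-(2 / p)) := (Real.mul_rpow (by norm_num) h2.le).symm
    _ ≤ D ^ (-(2 / p)) := by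
        refine Real.rpow_le_rpow_of_nonpos hD0 hDu ?_
        have : 0 < 2 / p := by positivity
        linarith

/-- Lower bound for the quadratic form on the explicit near optimizers. -/
theorem quadForm_optSet_ge (hpq : p.HolderConjugate q) (hp2 : p ≤ 2)
    (A : Matrix (Fin n) (Fin n) ℝ) (i : Fin n) (hS : 0 < rowSum q A i)
    (ht : |optVec p A i i| ≤ 1 / 5) {a : ℝ} (ha : |A i i| ≤ a)
    (hv : |bil A (offVec p A i) (offVec p A i)| ≤ a) :
    √2 * 2 ^ (-(2 / p)) * (rowSum q A i ^ (1 / q) * (1 - 5 * |optVec p A i i|)) - 5 * a ≤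
      quadForm A ((normP p (basisVec i + optVec p A i))⁻¹ • (basisVec i + optVec p A i)) := by
  have hp := hpq.pos
  obtain ⟨hc1, hc2⟩ := normP_basisVec_add_optVec_bounds hpq hp2 A i hS ht
  set c := (normP p (basisVec i + optVec p A i))⁻¹ with hc
  rw [quadForm_eq_bil, bil_smul_left, bil_smul_right, basisVec_add_optVec]
  set v := optVec p A i i with hv'
  set t := |v| with ht'
  have ht0 : 0 ≤ t := abs_nonneg _
  set R := rowSum q A i ^ (1 / q) with hR
  have hR0 : 0 ≤ R := Real.rpow_nonneg hS.le _
  have hvb := abs_le.1 (le_of_eq ht'.symm : |v| ≤ t)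
  have htp : t ^ p ≤ t := by
    simpa using Real.rpow_le_rpow_of_exponent_ge' ht0 (by linarith) zero_le_one hpq.lt.le
  have hee : bil A (basisVec i) (basisVec i) = A i i := by
    unfold bil
    simp [basisVec, Pi.single_apply]
  have hcross := bil_basisVec_offVec hpq A i hS
  rw [← hR, ← hv', ← ht'] at hcross
  set Q := bil A ((1 + v) • basisVec i + offVec p A i) ((1 + v) • basisVec i + offVec p A i)
    with hQ
  have hQe : Q = (1 + v) ^ 2 * A i i + (1 + v) * (√2 * (R * (1 - t ^ p))) +
      bil A (offVec p A i) (offVec p A i) := by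
    rw [hQ, bil_add_left, bil_add_right, bil_add_right, bil_smul_left, bil_smul_right,
      bil_smul_left, bil_smul_right, hee, ← hcross]
    ring
  -- Of the 5a, four come from the diagonal entry through (1 + v)² ≤ 4 and one from the form on
  -- `offVec`.
  have hQl : √2 * (R * (1 - 2 * t)) - 5 * a ≤ Q := by
    have e1 := (abs_le.1 ha).1
    have e2 := (abs_le.1 hv).1
    have ha0 : 0 ≤ a := (abs_nonneg _).trans ha
    have e3 : (1 + v) ^ 2 ≤ 4 := by nlinarith
    have e4 : -(4 * a) ≤ (1 + v) ^ 2 * A i i := by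
      have := mul_nonneg (sq_nonneg (1 + v)) (by linarith : 0 ≤ A i i + a)
      nlinarith
    have e5 : √2 * (R * (1 - 2 * t)) ≤ (1 + v) * (√2 * (R * (1 - t ^ p))) := by
      have : (1 - 2 * t) ≤ (1 + v) * (1 - t ^ p) := by
        nlinarith [mul_nonneg (by linarith : 0 ≤ 1 + v - (1 - t)) (by linarith : 0 ≤ 1 - t ^ p),
          mul_nonneg (by linarith : 0 ≤ 1 - t) (by linarith : 0 ≤ t - t ^ p)]
      calc √2 * (R * (1 - 2 * t)) ≤ √2 * (R * ((1 + v) * (1 - t ^ p))) := by gcongr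
        _ = _ := by ring
    rw [hQe]
    linarith
  have ha0 : 0 ≤ a := (abs_nonneg _).trans ha
  have h2p : 0 < (2 : ℝ) ^ (-(2 / p)) := by positivity
  calc _ ≤ √2 * 2 ^ (-(2 / p)) * (R * ((1 - 3 * t) * (1 - 2 * t))) - 5 * a := by
        gcongr
        nlinarith
    _ = 2 ^ (-(2 / p)) * (1 - 3 * t) * (√2 * (R * (1 - 2 * t))) - 5 * a := by ring
    _ ≤ c ^ 2 * (√2 * (R * (1 - 2 * t))) - c ^ 2 * (5 * a) := by
        refine sub_le_sub (mul_le_mul_of_nonneg_right hc2 ?_) ?_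
        · have : 0 ≤ 1 - 2 * t := by linarith
          positivity
        · nlinarith
    _ = c ^ 2 * (√2 * (R * (1 - 2 * t)) - 5 * a) := by ring
    _ ≤ c ^ 2 * Q := by gcongr
    _ = c * (c * Q) := by ring

theorem quadForm_neg (A : Matrix (Fin n) (Fin n) ℝ) (x : Fin n → ℝ) :
    quadForm A (-x) = quadForm A x := by
  simp [quadForm_eq_bil, bil]

end OptVec

/-! ### The explicit vectors: tail bounds -/

section Tails

variable {Ω : Type*} [MeasurableSpace Ω] {μ : Measure Ω} {n : ℕ}
  {G : Ω → Matrix (Fin n) (Fin n) ℝ} {p q : ℝ}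

/-- The n - 1 off-diagonal entries of a symmetrized row are i.i.d. standard; the diagonal one has
another variance and is discarded, as it only increases the sum. -/
theorem IsStdGaussianMatrix.rowSum_tail (h : IsStdGaussianMatrix μ G) (hq : 0 < q) (hn : 1 ≤ n)
    (i : Fin n) {s : ℝ} (hs : 0 ≤ s) :
    μ.real {ω | rowSum q (G ω) i ≤ (n - 1 : ℝ) * gaussMoment q - s} ≤
      Real.exp (-s ^ 2 / (2 * n * gaussMoment (2 * q))) := by
  have := h.indep.isProbabilityMeasure
  have hfam := h.symm_family (u := basisVec i) (by simp [basisVec, Pi.single_apply])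
  have hsub : ∀ j, basisVec i j = 0 ↔ j ∈ Finset.univ.erase i := fun j => by
    simp [basisVec, Pi.single_apply]
  have hcard : Fintype.card {j : Fin n // basisVec i j = 0} = n - 1 := by
    rw [Fintype.card_of_subtype (Finset.univ.erase i) fun j => (hsub j).symm]
    simp
  refine (measureReal_mono (fun ω hω => ?_) (measure_ne_top _ _)).trans
    (hfam.sum_abs_rpow_lower_tail hq hn (by rw [hcard]; omega) hs)
  simp only [Set.mem_ofPred_eq] at hω ⊢
  rw [hcard, Nat.cast_sub hn, Nat.cast_one]
  refine le_trans ?_ hω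
  have e : ∀ j : Fin n, (√2)⁻¹ * ∑ l, (G ω j l + G ω l j) * basisVec i l =
      symMatrix (G ω) i j := fun j => by
    rw [symMatrix_apply, add_comm (G ω i j)]
    simp [basisVec, Pi.single_apply]
  simp only [e]
  rw [← Finset.sum_subtype (Finset.univ.erase i) (fun j => (hsub j).symm)
    (fun j => |symMatrix (G ω) i j| ^ q), rowSum_eq_add]
  have : 0 ≤ |symMatrix (G ω) i i| ^ q := by positivity
  linarith

/-- Conditionally on row and column i the vector is fixed. Since it vanishes at i, the form uses
only the other entries, with coefficients of total square at most 1. -/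
theorem IsStdGaussianMatrix.offVec_tail (h : IsStdGaussianMatrix μ G)
    (hpq : p.HolderConjugate q) (hp2 : p ≤ 2) (i : Fin n) {a : ℝ} (ha : 0 ≤ a) :
    μ.real {ω | a ≤ |bil (G ω) (offVec p (G ω) i) (offVec p (G ω) i)|} ≤
      2 * Real.exp (-a ^ 2 / 2) := by
  set S : Finset (Fin n × Fin n) := Finset.univ.filter fun ab => ab.1 = i ∨ ab.2 = i with hS
  -- Padding the observed entries with zeros gives a matrix with the same row and column i, at which
  -- `offVec` can be evaluated.
  let M : (S → ℝ) → Matrix (Fin n) (Fin n) ℝ := fun y a b =>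
    if hab : (a, b) ∈ S then y ⟨(a, b), hab⟩ else 0
  have hM : ∀ a b, Measurable fun y => M y a b := fun a b => by
    by_cases hab : (a, b) ∈ S
    · simp only [M, hab, dif_pos]
      exact measurable_pi_apply _
    · simp only [M, hab, dif_neg, not_false_eq_true]
      exact measurable_const
  have hsym : ∀ j, Measurable fun y => symMatrix (M y) i j := fun j => by
    simp only [symMatrix_apply]
    exact ((hM i j).add (hM j i)).const_mul _
  have hoff : ∀ j, Measurable fun y => offVec p (M y) i j := fun j => by
    unfold offVec
    split_ifs
    · exact measurable_const
    · simp only [optVec_apply hpq]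
      refine (measurable_sgn.comp (hsym j)).mul (Measurable.pow_const (Measurable.div ?_ ?_) _)
      · exact ((hsym j).abs).pow_const _
      · exact Finset.measurable_fun_sum _ fun l _ => ((hsym l).abs).pow_const _
  have hc1 : ∀ y, ∑ t : ↥(Sᶜ), (offVec p (M y) i t.1.1 * offVec p (M y) i t.1.2) ^ 2 ≤ 1 := by
    intro y
    have h1 := sum_offVec_sq_le hpq hp2 (M y) i
    have h0 : 0 ≤ ∑ j, offVec p (M y) i j ^ 2 := Finset.sum_nonneg fun i _ => sq_nonneg _
    calc _ = ∑ t ∈ Sᶜ, (offVec p (M y) i t.1 * offVec p (M y) i t.2) ^ 2 :=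
          Finset.sum_coe_sort Sᶜ fun t : Fin n × Fin n =>
            (offVec p (M y) i t.1 * offVec p (M y) i t.2) ^ 2
      _ ≤ ∑ t : Fin n × Fin n, (offVec p (M y) i t.1 * offVec p (M y) i t.2) ^ 2 :=
          Finset.sum_le_sum_of_subset_of_nonneg (Finset.subset_univ _) fun t _ _ => sq_nonneg _
      _ = (∑ j, offVec p (M y) i j ^ 2) * ∑ j, offVec p (M y) i j ^ 2 := by
          rw [Fintype.sum_prod_type, Finset.sum_mul_sum]
          simp only [mul_pow]
      _ ≤ 1 := by nlinarith
  have htail := h.family.conditional_tail S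
    (c := fun y ab => offVec p (M y) i ab.1 * offVec p (M y) i ab.2)
    (fun ab => (hoff ab.1).mul (hoff ab.2)) hc1 ha
  convert htail using 5 with ω
  have hopt : optVec p (M fun s : S => G ω s.1.1 s.1.2) i = optVec p (G ω) i := by
    refine optVec_congr (fun j => ⟨?_, ?_⟩) hpq <;> simp [M, hS]
  have hoffe : offVec p (M fun s : S => G ω s.1.1 s.1.2) i = offVec p (G ω) i := by
    unfold offVec
    rw [hopt]
  rw [hoffe]
  have e1 : bil (G ω) (offVec p (G ω) i) (offVec p (G ω) i) = ∑ t : Fin n × Fin n,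
      offVec p (G ω) i t.1 * offVec p (G ω) i t.2 * G ω t.1 t.2 := by
    rw [Fintype.sum_prod_type]
    exact Finset.sum_congr rfl fun a _ => Finset.sum_congr rfl fun b _ => by ring
  rw [e1, Finset.sum_coe_sort Sᶜ fun t : Fin n × Fin n =>
    offVec p (G ω) i t.1 * offVec p (G ω) i t.2 * G ω t.1 t.2]
  congr 1
  symm
  refine Finset.sum_subset (Finset.subset_univ (Sᶜ)) fun t _ ht => ?_
  have ht' : t.1 = i ∨ t.2 = i := by simpa [hS, or_iff_not_imp_left] using ht
  rcases ht' with h1 | h1 <;> simp [offVec, h1]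

end Tails

/-! ### Near optimizers and the almost sure lower bound -/

section NearOptimizers

variable {p q : ℝ}

theorem two_lt_conjExponent (hp1 : 1 < p) (hp2 : p < 2) : 2 < p.conjExponent := by
  rw [Real.conjExponent, lt_div_iff₀ (by linarith)]
  linarith

theorem eventually_diagonal_small (hpq : p.HolderConjugate q) (hp2 : p < q) {c m : ℝ}
    (hc : 0 ≤ c) (hm : 0 < m) :
    ∀ᶠ n : ℕ in atTop, (n : ℝ) ^ (1 / q) * (√(c * Real.log n) ^ q / (n * m / 2)) ^ (1 / p) ≤
      1 / 5 := by
  have hp := hpq.pos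
  have hq := hpq.symm.pos
  -- With this exponent the expression is a constant times (√(c log n) n^(-α))^(q/p), which tends to
  -- 0.
  set α := (1 / p - 1 / q) * (p / q) with hα
  have hα0 : 0 < α := by
    have : 1 / q < 1 / p := one_div_lt_one_div_of_lt hp hp2
    exact mul_pos (by linarith) (by positivity)
  have hqp : 0 < q / p := by positivity
  have h1 := ((tendsto_sqrt_log_mul_rpow_neg hα0 hc).rpow_const
    (Or.inr hqp.le : _ ∨ 0 ≤ q / p)).mul_const ((m / 2) ^ (-(1 / p)))
  rw [Real.zero_rpow hqp.ne', zero_mul] at h1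
  filter_upwards [h1.eventually (ge_mem_nhds (by norm_num : (0 : ℝ) < 1 / 5)),
    eventually_ge_atTop 1] with n hn hn1
  have hn0 : (0 : ℝ) < n := by exact_mod_cast hn1
  refine le_of_eq_of_le ?_ hn
  set X := √(c * Real.log n)
  have hX : 0 ≤ X := Real.sqrt_nonneg _
  rw [Real.mul_rpow hX (by positivity), Real.div_rpow (by positivity) (by positivity),
    ← Real.rpow_mul hX, ← Real.rpow_mul hn0.le, mul_div_assoc,
    Real.mul_rpow hn0.le (by positivity), Real.rpow_neg (by positivity : 0 ≤ m / 2)]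
  have e1 : -α * (q / p) = 1 / q - 1 / p := by
    rw [hα]
    field_simp
    ring
  rw [e1, Real.rpow_sub hn0, mul_one_div]
  field_simp

theorem eventually_deviation_small {c m : ℝ} (hc : 0 ≤ c) (hm : 0 < m) :
    ∀ᶠ n : ℕ in atTop, m + √(c * Real.log n) * √n ≤ n * m / 2 := by
  have h1 := tendsto_sqrt_log_mul_rpow_neg (a := 1 / 2) (by norm_num) hc
  filter_upwards [h1.eventually (ge_mem_nhds (by positivity : (0 : ℝ) < m / 4)),
    eventually_ge_atTop 4] with n hn hn4
  have hn4' : (4 : ℝ) ≤ n := by exact_mod_cast hn4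
  have hn0 : (0 : ℝ) < n := by linarith
  have e : √(n : ℝ) = (n : ℝ) ^ (-(1 / 2 : ℝ)) * n := by
    nth_rewrite 3 [← Real.rpow_one (n : ℝ)]
    rw [← Real.rpow_add hn0, Real.sqrt_eq_rpow]
    norm_num
  rw [e, ← mul_assoc]
  nlinarith

/-- The relative error of S is of order √(log n / n), and n^(1/q) ≤ √n because q > 2, so its cost is
O(√log n). The diagonal costs O(1), since n^(1/q) t stays bounded. -/
theorem lower_bound_of_rowSum (hpq : p.HolderConjugate q) (hp2 : p < 2) (hq2 : 2 < q) {b : ℝ}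
    (hb : 0 ≤ b) {c₀ : ℝ} (hc₀ : 0 ≤ c₀) :
    ∃ C : ℝ, 0 < C ∧ ∀ᶠ n : ℕ in atTop, ∀ S t : ℝ, 0 ≤ t →
      (n - 1 : ℝ) * gaussMoment q - √(2 * gaussMoment (2 * q) * b * Real.log n) * √n ≤ S →
      t ^ p ≤ √(4 * b * Real.log n) ^ q / S →
      0 < S ∧ t ≤ 1 / 5 ∧
        c₀ * (gaussMoment q ^ (1 / q) * (n : ℝ) ^ (1 / q)) - C * √(Real.log n) ≤
          c₀ * (S ^ (1 / q) * (1 - 5 * t)) - 5 * √(2 * b * Real.log n) := by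
  have hp := hpq.pos
  have hq := hpq.symm.pos
  set m := gaussMoment q with hmdef
  set M := gaussMoment (2 * q) with hMdef
  have hm : 0 < m := gaussMoment_pos hq.le
  have hM : 0 < M := gaussMoment_pos (by positivity)
  set ξ := m ^ (1 / q) with hξ
  have hξ0 : 0 < ξ := by positivity
  -- The 2 collects the missing entry in n - 1 and the diagonal coordinate, the quotient the row-sum
  -- deviation, and 5√(2b) the remaining quadratic errors; the final 1 ensures positivity.
  refine ⟨c₀ * ξ * (2 + √(2 * M * b) / m) + 5 * √(2 * b) + 1, by positivity, ?_⟩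
  filter_upwards [eventually_diagonal_small hpq (by linarith) (c := 4 * b) (by positivity) hm,
    eventually_deviation_small (c := 2 * M * b) (by positivity) hm,
    eventually_ge_atTop 3] with n h1 h2 hn S t ht hS htS
  have hn3 : (3 : ℝ) ≤ n := by exact_mod_cast hn
  have hn0 : (0 : ℝ) < n := by linarith
  set l := Real.log n with hl
  have hl1 : 1 ≤ √l := by
    rw [Real.one_le_sqrt, hl, Real.le_log_iff_exp_le hn0]
    exact Real.exp_one_lt_d9.le.trans (by linarith)
  set s := √(2 * M * b * l) * √n with hs
  have hs0 : 0 ≤ s := by positivity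
  have hSl : n * m - (m + s) ≤ S := by linarith
  have hSh : n * m / 2 ≤ S := by linarith
  have hS0 : 0 < S := lt_of_lt_of_le (by positivity) hSh
  set y := (n : ℝ) ^ (1 / q) with hy
  have hy1 : 1 ≤ y := Real.one_le_rpow (by linarith) (by positivity)
  have hyt : y * t ≤ 1 / 5 := by
    refine le_trans ?_ h1
    gcongr
    rw [one_div, Real.le_rpow_inv_iff_of_pos ht (by positivity) hp]
    exact htS.trans (by gcongr)
  have ht5 : t ≤ 1 / 5 := le_trans (le_mul_of_one_le_left ht hy1) hyt
  refine ⟨hS0, ht5, ?_⟩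
  set κ := (m + s) / (n * m) with hκ
  have hκ0 : 0 ≤ κ := by positivity
  have hκ1 : κ ≤ 1 / 2 := by
    rw [hκ, div_le_iff₀ (by positivity)]
    linarith
  have hR : y * ξ * (1 - κ) ≤ S ^ (1 / q) := by
    have e1 : n * m * (1 - κ) ≤ S := by
      refine le_of_eq_of_le ?_ hSl
      rw [hκ]
      field_simp
    calc y * ξ * (1 - κ) ≤ y * ξ * (1 - κ) ^ (1 / q) := by
          gcongr
          nth_rewrite 1 [← Real.rpow_one (1 - κ)]
          refine Real.rpow_le_rpow_of_exponent_ge (by linarith) (by linarith) ?_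
          rw [div_le_one hq]
          linarith
      _ = (n * m * (1 - κ)) ^ (1 / q) := by
          rw [Real.mul_rpow (by positivity) (by linarith), Real.mul_rpow hn0.le hm.le]
      _ ≤ S ^ (1 / q) := by
          have : 0 ≤ 1 - κ := by linarith
          gcongr
  have hyκ : y * κ ≤ (1 + √(2 * M * b) / m) * √l := by
    have e1 : y ≤ √n := by
      rw [hy, Real.sqrt_eq_rpow]
      refine Real.rpow_le_rpow_of_exponent_le (by linarith) ?_
      exact one_div_le_one_div_of_le (by norm_num) hq2.le
    have e2 : √(n : ℝ) * √n = n := Real.mul_self_sqrt hn0.le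
    have e3 : √(2 * M * b * l) = √(2 * M * b) * √l := Real.sqrt_mul (by positivity) _
    have e4 : √(n : ℝ) ≤ n := by
      rw [Real.sqrt_le_left hn0.le]
      nlinarith
    calc y * κ ≤ √n * κ := by gcongr
      _ = √n / n + √(2 * M * b) * √l / m := by
          rw [hκ, hs, e3]
          field_simp
          linear_combination (√(2 * M * b) * √l) * e2
      _ ≤ 1 + √(2 * M * b) * √l / m := by
          gcongr
          rwa [div_le_one hn0]
      _ ≤ √l + √(2 * M * b) * √l / m := by gcongr
      _ = _ := by ring
  have hmain : ξ * y - ξ * (2 + √(2 * M * b) / m) * √l ≤ S ^ (1 / q) * (1 - 5 * t) := by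
    have e1 : y * ξ * (1 - κ) * (1 - 5 * t) ≤ S ^ (1 / q) * (1 - 5 * t) :=
      mul_le_mul_of_nonneg_right hR (by linarith)
    refine le_trans ?_ e1
    have e2 : 1 - κ - 5 * t ≤ (1 - κ) * (1 - 5 * t) := by linarith [mul_nonneg hκ0 ht]
    have e3 : y * ξ * (1 - κ - 5 * t) ≤ y * ξ * ((1 - κ) * (1 - 5 * t)) := by gcongr
    have e4 : ξ * (y * κ + 5 * (y * t)) ≤ ξ * ((1 + √(2 * M * b) / m) * √l + √l) := by
      refine mul_le_mul_of_nonneg_left ?_ hξ0.le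
      linarith
    calc ξ * y - ξ * (2 + √(2 * M * b) / m) * √l =
          y * ξ - ξ * ((1 + √(2 * M * b) / m) * √l + √l) := by ring
      _ ≤ y * ξ - ξ * (y * κ + 5 * (y * t)) := by linarith
      _ = y * ξ * (1 - κ - 5 * t) := by ring
      _ ≤ _ := e3
      _ = _ := by ring
  have hlast : √(2 * b * l) = √(2 * b) * √l := Real.sqrt_mul (by positivity) _
  rw [hlast]
  have := mul_le_mul_of_nonneg_left hmain hc₀
  linarith

/-- Each threshold makes its exponential equal to n^(-d-1). The three prefactors 2, 2 and 1 add to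
5, and the n rows use up one power of n. -/
theorem IsStdGaussianMatrix.row_fail {Ω : Type*} [MeasurableSpace Ω] {μ : Measure Ω} {n : ℕ}
    {G : Ω → Matrix (Fin n) (Fin n) ℝ} (h : IsStdGaussianMatrix μ G)
    (hpq : p.HolderConjugate q) (hp2 : p ≤ 2) (hn : 1 ≤ n) {d : ℝ} (hd : 0 < d) :
    μ.real (⋃ i : Fin n,
      (({ω | √(2 * (d + 1) * Real.log n) ≤ |G ω i i|} ∪
      {ω | √(2 * (d + 1) * Real.log n) ≤ |bil (G ω) (offVec p (G ω) i) (offVec p (G ω) i)|}) ∪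
      {ω | rowSum q (G ω) i ≤ (n - 1 : ℝ) * gaussMoment q -
        √(2 * gaussMoment (2 * q) * (d + 1) * Real.log n) * √n})) ≤ 5 * (n : ℝ) ^ (-d) := by
  have := h.indep.isProbabilityMeasure
  have hn1 : (1 : ℝ) ≤ n := by exact_mod_cast hn
  have hn0 : (0 : ℝ) < n := by linarith
  have hl : 0 ≤ Real.log n := Real.log_nonneg hn1
  have hM : 0 < gaussMoment (2 * q) := gaussMoment_pos (by have := hpq.symm.pos; positivity)
  have hexp : ∀ x : ℝ, x = -(d + 1) * Real.log n → Real.exp x = (n : ℝ) ^ (-d) * (n : ℝ)⁻¹ := by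
    intro x hx
    rw [hx, ← Real.rpow_neg_one, ← Real.rpow_add hn0, Real.rpow_def_of_pos hn0]
    congr 1
    ring
  have e1 : Real.exp (-√(2 * (d + 1) * Real.log n) ^ 2 / 2) = (n : ℝ) ^ (-d) * (n : ℝ)⁻¹ := by
    apply hexp
    rw [Real.sq_sqrt (by positivity)]
    ring
  have e2 : Real.exp (-(√(2 * gaussMoment (2 * q) * (d + 1) * Real.log n) * √n) ^ 2 /
      (2 * n * gaussMoment (2 * q))) = (n : ℝ) ^ (-d) * (n : ℝ)⁻¹ := by
    apply hexp
    rw [mul_pow, Real.sq_sqrt (by positivity), Real.sq_sqrt hn0.le]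
    field_simp
  refine (measureReal_iUnion_fintype_le _).trans ?_
  calc _ ≤ ∑ _i : Fin n, 5 * ((n : ℝ) ^ (-d) * (n : ℝ)⁻¹) := by
        refine Finset.sum_le_sum fun i _ => ?_
        have t1 := h.family.abs_tail (i, i) (Real.sqrt_nonneg (2 * (d + 1) * Real.log n))
        have t2 := h.offVec_tail hpq hp2 i (Real.sqrt_nonneg (2 * (d + 1) * Real.log n))
        have t3 := h.rowSum_tail hpq.symm.pos hn i (s :=
          √(2 * gaussMoment (2 * q) * (d + 1) * Real.log n) * √n) (by positivity)
        rw [e1] at t1 t2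
        rw [e2] at t3
        refine (measureReal_union_le _ _).trans ?_
        have t4 := measureReal_union_le (μ := μ) {ω | √(2 * (d + 1) * Real.log n) ≤ |G ω i i|}
          {ω | √(2 * (d + 1) * Real.log n) ≤
            |bil (G ω) (offVec p (G ω) i) (offVec p (G ω) i)|}
        linarith
    _ = 5 * (n : ℝ) ^ (-d) := by
        rw [Finset.sum_const, Finset.card_univ, Fintype.card_fin, nsmul_eq_mul]
        field_simp

theorem two_rpow_half_sub (p : ℝ) : (2 : ℝ) ^ ((1 : ℝ) / 2 - 2 / p) = √2 * 2 ^ (-(2 / p)) := by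
  rw [Real.sqrt_eq_rpow, ← Real.rpow_add (by norm_num)]
  rfl

/-- All the explicit vectors are near optimizers with high probability. -/
theorem exists_const_optSet (hpq : p.HolderConjugate q) (hp2 : p < 2) (hq2 : 2 < q) {d : ℝ}
    (hd : 0 < d) :
    ∃ C : ℝ, 0 < C ∧ ∀ (Ω : Type*) [MeasurableSpace Ω] (μ : Measure Ω) [IsProbabilityMeasure μ]
      (n : ℕ) (_ : 1 ≤ n) (G : Ω → Matrix (Fin n) (Fin n) ℝ), IsStdGaussianMatrix μ G →
        μ.real {ω | ¬ ∀ x ∈ optSet p (G ω),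
          (2 : ℝ) ^ ((1 : ℝ) / 2 - 2 / p) * xi q * (n : ℝ) ^ (1 / q) - C * √(Real.log n) ≤
            quadForm (G ω) x} ≤ C * (n : ℝ) ^ (-d) := by
  have hp := hpq.pos
  have hq := hpq.symm.pos
  obtain ⟨C, hC, hev⟩ := lower_bound_of_rowSum hpq hp2 hq2 (b := d + 1) (by positivity)
    (c₀ := √2 * 2 ^ (-(2 / p))) (by positivity)
  obtain ⟨n₀, hn₀⟩ := eventually_atTop.1 hev
  -- The 5 covers the failure probability, and n₀^d makes the claim trivial for n < n₀.
  refine ⟨C + 5 + (n₀ : ℝ) ^ d, by positivity, fun Ω _ μ _ n hn G hG => ?_⟩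
  have hn0 : (0 : ℝ) < n := by exact_mod_cast hn
  have hnd : 0 < (n : ℝ) ^ (-d) := by positivity
  have hn0d : 0 ≤ (n₀ : ℝ) ^ d := by positivity
  rcases lt_or_ge n n₀ with hlt | hge
  · refine measureReal_le_one.trans ?_
    have h1 : 1 ≤ (n₀ : ℝ) ^ d * (n : ℝ) ^ (-d) := by
      rw [Real.rpow_neg hn0.le, ← div_eq_mul_inv, one_le_div (by positivity)]
      exact Real.rpow_le_rpow hn0.le (by exact_mod_cast hlt.le) hd.le
    nlinarith [mul_pos hC hnd]
  set B := ⋃ i : Fin n,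
      (({ω | √(2 * (d + 1) * Real.log n) ≤ |G ω i i|} ∪
      {ω | √(2 * (d + 1) * Real.log n) ≤ |bil (G ω) (offVec p (G ω) i) (offVec p (G ω) i)|}) ∪
      {ω | rowSum q (G ω) i ≤ (n - 1 : ℝ) * gaussMoment q -
        √(2 * gaussMoment (2 * q) * (d + 1) * Real.log n) * √n}) with hB
  have hsub : {ω | ¬ ∀ x ∈ optSet p (G ω),
      (2 : ℝ) ^ ((1 : ℝ) / 2 - 2 / p) * xi q * (n : ℝ) ^ (1 / q) -
        (C + 5 + (n₀ : ℝ) ^ d) * √(Real.log n) ≤ quadForm (G ω) x} ⊆ B := by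
    intro ω hωT
    by_contra hωB
    refine hωT ?_
    rw [hB] at hωB
    simp only [Set.mem_iUnion, Set.mem_union, Set.mem_ofPred_eq, not_exists, not_or,
      not_le] at hωB
    have key : ∀ i : Fin n, (2 : ℝ) ^ ((1 : ℝ) / 2 - 2 / p) * xi q * (n : ℝ) ^ (1 / q) -
        (C + 5 + (n₀ : ℝ) ^ d) * √(Real.log n) ≤ quadForm (G ω)
          ((normP p (basisVec i + optVec p (G ω) i))⁻¹ •
            (basisVec i + optVec p (G ω) i)) := by
      intro i
      obtain ⟨⟨h1, h2⟩, h3⟩ := hωB i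
      -- The diagonal of the symmetrized matrix is √2 times the original one, which turns the 2
      -- under the root into 4.
      have hdiag : |symMatrix (G ω) i i| ≤ √(4 * (d + 1) * Real.log n) := by
        have e1 : symMatrix (G ω) i i = √2 * G ω i i := by
          rw [symMatrix_apply, ← two_mul, ← mul_assoc]
          congr 1
          rw [inv_mul_eq_div, Real.div_sqrt]
        have e2 : √(4 * (d + 1) * Real.log n) = √2 * √(2 * (d + 1) * Real.log n) := by
          rw [← Real.sqrt_mul (by norm_num)]
          congr 1
          ring
        rw [e1, e2, abs_mul, abs_of_nonneg (Real.sqrt_nonneg _)]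
        gcongr
      have htp : |optVec p (G ω) i i| ^ p ≤
          √(4 * (d + 1) * Real.log n) ^ q / rowSum q (G ω) i := by
        rw [abs_optVec_rpow hpq]
        have := rowSum_nonneg (q := q) (G ω) i
        gcongr
      obtain ⟨hS, ht, hbound⟩ := hn₀ n hge _ _ (abs_nonneg _) h3.le htp
      refine le_trans ?_ (hbound.trans (quadForm_optSet_ge hpq hp2.le _ i hS ht h1.le h2.le))
      rw [two_rpow_half_sub p]
      have hxi : xi q = gaussMoment q ^ (1 / q) := rfl
      rw [hxi, mul_assoc]
      have : 0 ≤ √(Real.log n) := Real.sqrt_nonneg _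
      nlinarith
    rintro x ⟨i, rfl | rfl⟩
    · exact key i
    · rw [quadForm_neg]
      exact key i
  refine (measureReal_mono hsub (measure_ne_top _ _)).trans
    ((hG.row_fail hpq hp2.le hn hd).trans ?_)
  nlinarith [mul_pos hC hnd]

/-- Positivity of the form excludes the zero vector produced by a vanishing denominator, so the
vector lies on the unit sphere. -/
theorem le_maxForm_of_mem_optSet (hp : 1 ≤ p) {n : ℕ} (hn : 1 ≤ n)
    {A : Matrix (Fin n) (Fin n) ℝ} {x : Fin n → ℝ} (hx : x ∈ optSet p A)
    (h0 : 0 < quadForm A x) : quadForm A x ≤ maxForm p A := by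
  refine (isGreatest_maxForm hp hn A).2 ⟨x, ?_, rfl⟩
  have hp0 : 0 < p := by linarith
  have hsmul : ∀ (c : ℝ) (y : Fin n → ℝ), normP p (c • y) = |c| * normP p y := fun c y => by
    unfold normP
    simp only [Pi.smul_apply, smul_eq_mul, abs_mul]
    simp only [Real.mul_rpow (abs_nonneg _) (abs_nonneg _)]
    rw [← Finset.mul_sum, Real.mul_rpow (by positivity)
      (Finset.sum_nonneg fun i _ => by positivity), rpow_one_div_rpow (abs_nonneg _) hp0.ne']
  have hnn : ∀ y : Fin n → ℝ, 0 ≤ normP p y := fun y => by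
    have : 0 ≤ ∑ i, |y i| ^ p := Finset.sum_nonneg fun i _ => by positivity
    unfold normP
    positivity
  obtain ⟨i, hi⟩ := hx
  set y := basisVec i + optVec p A i with hy
  have hN : normP p y ≠ 0 := by
    intro hN
    have hx0 : x = 0 := by rcases hi with rfl | rfl <;> simp [hN]
    rw [hx0] at h0
    simp [quadForm] at h0
  have h1 : normP p ((normP p y)⁻¹ • y) = 1 := by
    rw [hsmul, abs_of_nonneg (inv_nonneg.2 (hnn y)), inv_mul_cancel₀ hN]
  rcases hi with rfl | rfl
  · exact h1
  · change normP p _ = 1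
    rw [← h1]
    unfold normP
    simp only [Pi.neg_apply, abs_neg]

theorem ae_eventually_le_maxForm {Ω : Type*} [MeasurableSpace Ω] {μ : Measure Ω}
    [IsProbabilityMeasure μ] {G : (n : ℕ) → Ω → Matrix (Fin n) (Fin n) ℝ}
    (hG : ∀ n, IsStdGaussianMatrix μ (G n)) (hpq : p.HolderConjugate q) (hp2 : p < 2)
    (hq2 : 2 < q) :
    ∃ C : ℝ, 0 ≤ C ∧ ∀ᵐ ω ∂μ, ∀ᶠ n : ℕ in atTop,
      (n : ℝ) ^ (1 / q) * ((2 : ℝ) ^ ((1 : ℝ) / 2 - 2 / p) * xi q -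
        √(C * Real.log n) * (n : ℝ) ^ (-(1 / q))) ≤ maxForm p (G n ω) := by
  have hq := hpq.symm.pos
  obtain ⟨C, hC, h⟩ := exists_const_optSet hpq hp2 hq2 (d := 2) (by norm_num)
  -- Squaring moves the constant under the root, since √(C² log n) = C √log n.
  refine ⟨C ^ 2, by positivity, ?_⟩
  have hxi : 0 < xi q := Real.rpow_pos_of_pos (gaussMoment_pos hq.le) _
  set b := (2 : ℝ) ^ ((1 : ℝ) / 2 - 2 / p) * xi q with hb
  have hb0 : 0 < b := by positivity
  have hE := ae_eventually_notMem_of_measureReal_le (μ := μ)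
    (E := fun n => {ω | ¬ ∀ x ∈ optSet p (G n ω),
      b * (n : ℝ) ^ (1 / q) - C * √(Real.log n) ≤ quadForm (G n ω) x}) (C := C) <| by
    filter_upwards [eventually_ge_atTop 1] with n hn
    exact h Ω μ n hn (G n) (hG n)
  have hlim := tendsto_sqrt_log_mul_rpow_neg (a := 1 / q) (c := C ^ 2) (by positivity)
    (by positivity)
  filter_upwards [hE] with ω hω
  filter_upwards [hω, eventually_ge_atTop 1, hlim.eventually (gt_mem_nhds hb0)] with n h1 hn h2
  have hn0 : (0 : ℝ) < n := by exact_mod_cast hn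
  have hx : (normP p (basisVec ⟨0, hn⟩ + optVec p (G n ω) ⟨0, hn⟩))⁻¹ •
      (basisVec ⟨0, hn⟩ + optVec p (G n ω) ⟨0, hn⟩) ∈ optSet p (G n ω) := ⟨_, Or.inl rfl⟩
  have h3 := not_not.1 h1 _ hx
  have e : (n : ℝ) ^ (1 / q) * (b - √(C ^ 2 * Real.log n) * (n : ℝ) ^ (-(1 / q))) =
      b * (n : ℝ) ^ (1 / q) - C * √(Real.log n) := by
    rw [Real.sqrt_mul (by positivity), Real.sqrt_sq hC.le, Real.rpow_neg hn0.le]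
    field_simp
  rw [e]
  refine h3.trans (le_maxForm_of_mem_optSet hpq.lt.le hn hx (lt_of_lt_of_le ?_ h3))
  rw [← e]
  have : 0 < b - √(C ^ 2 * Real.log n) * (n : ℝ) ^ (-(1 / q)) := by linarith
  positivity

end NearOptimizers

end LpGrothendieck

/-! ### The main theorem -/

theorem theorem1p2 (p : ℝ) (hp1 : 1 < p) (hp2 : p < 2) :
    -- (i) almost sure convergence of the scaled maximum
    (∀ (Ω : Type*) [MeasurableSpace Ω] (μ : Measure Ω) [IsProbabilityMeasure μ]
        (G : (n : ℕ) → Ω → Matrix (Fin n) (Fin n) ℝ),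
        (∀ n, LpGrothendieck.IsStdGaussianMatrix μ (G n)) →
        ∀ᵐ ω ∂μ, Tendsto
          (fun n : ℕ => 1 / (n : ℝ) ^ (1 / p.conjExponent) * LpGrothendieck.maxForm p (G n ω))
          atTop
          (𝓝 ((2 : ℝ) ^ ((1 : ℝ) / 2 - 2 / p) * LpGrothendieck.xi p.conjExponent))) ∧
    -- (ii) every vector of the explicit set is a near optimizer
    (∀ d : ℝ, 0 < d → ∃ C : ℝ, 0 < C ∧
      ∀ (Ω : Type*) [MeasurableSpace Ω] (μ : Measure Ω) [IsProbabilityMeasure μ]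
        (n : ℕ) (_ : 1 ≤ n) (G : Ω → Matrix (Fin n) (Fin n) ℝ),
        LpGrothendieck.IsStdGaussianMatrix μ G →
        1 - C * (n : ℝ) ^ (-d) ≤
          μ.real {ω | ∀ x ∈ LpGrothendieck.optSet p (G ω),
            (2 : ℝ) ^ ((1 : ℝ) / 2 - 2 / p) * LpGrothendieck.xi p.conjExponent *
                (n : ℝ) ^ (1 / p.conjExponent) -
              C * ((n : ℝ) ^ (-(1 / p) + 1 / 2 + 1 / p.conjExponent) *
                    Real.log n ^ (p.conjExponent / 4) + √(Real.log n)) ≤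
              LpGrothendieck.quadForm (G ω) x}) := by
  have hpq : p.HolderConjugate p.conjExponent := Real.HolderConjugate.conjExponent hp1
  have hq2 := LpGrothendieck.two_lt_conjExponent hp1 hp2
  have hp0 : 0 < p := by linarith
  set q := p.conjExponent with hq
  have hq0 : 0 < q := by linarith
  refine ⟨fun Ω _ μ _ G hG => ?_, fun d hd => ?_⟩
  · have hup := LpGrothendieck.ae_eventually_maxForm_le hG hpq hp2 hq2
    obtain ⟨C, hC, hlow⟩ := LpGrothendieck.ae_eventually_le_maxForm hG hpq hp2 hq2
    have hl1 := LpGrothendieck.tendsto_upperSeq hp0 hp2 hq2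
    have hl2 := (LpGrothendieck.tendsto_sqrt_log_mul_rpow_neg (a := 1 / q)
      (by positivity) hC).const_sub
        ((2 : ℝ) ^ ((1 : ℝ) / 2 - 2 / p) * LpGrothendieck.xi q)
    rw [← LpGrothendieck.two_rpow_half_sub] at hl1
    rw [sub_zero] at hl2
    filter_upwards [hup, hlow] with ω h1 h2
    refine tendsto_of_tendsto_of_tendsto_of_le_of_le' hl2 hl1 ?_ ?_
    · filter_upwards [h2, eventually_ge_atTop 1] with n hn hn1
      have hn0 : (0 : ℝ) < n := by exact_mod_cast hn1
      rwa [one_div_mul_eq_div, le_div_iff₀' (by positivity)]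
    · filter_upwards [h1, eventually_ge_atTop 1] with n hn hn1
      have hn0 : (0 : ℝ) < n := by exact_mod_cast hn1
      rwa [one_div_mul_eq_div, div_le_iff₀' (by positivity)]
  · obtain ⟨C, hC, h⟩ := LpGrothendieck.exists_const_optSet hpq hp2 hq2 hd
    refine ⟨C, hC, fun Ω _ μ _ n hn G hG => ?_⟩
    have hn1 : (1 : ℝ) ≤ n := by exact_mod_cast hn
    have h1 := h Ω μ n hn G hG
    have hl : 0 ≤ Real.log n := Real.log_nonneg hn1
    -- The first error term of the statement is nonnegative, so the bound with √log n alone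
    -- suffices.
    have herr : 0 ≤ C * ((n : ℝ) ^ (-(1 / p) + 1 / 2 + 1 / q) * Real.log n ^ (q / 4)) := by
      positivity
    set T := {ω | ∀ x ∈ LpGrothendieck.optSet p (G ω),
      (2 : ℝ) ^ ((1 : ℝ) / 2 - 2 / p) * LpGrothendieck.xi q * (n : ℝ) ^ (1 / q) -
        C * √(Real.log n) ≤ LpGrothendieck.quadForm (G ω) x}
    -- Subadditivity on T and its complement avoids proving that T is measurable.
    have h2 : (1 : ℝ) ≤ μ.real T + μ.real Tᶜ := by
      calc (1 : ℝ) = μ.real (T ∪ Tᶜ) := by simp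
        _ ≤ _ := measureReal_union_le _ _
    have h3 : μ.real Tᶜ ≤ C * (n : ℝ) ^ (-d) := h1
    refine le_trans (by linarith) (measureReal_mono (s₁ := T) (fun ω hω => ?_)
      (measure_ne_top _ _))
    intro x hx
    have h4 := hω x hx
    linarith
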